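/- Let $\mathbb D$ be the open unit disc, $\mathbb T$ the unit circle, $H^2$ the Hardy space of holomorphic functions on $\mathbb D$ with square-summable Taylor coefficients, and $H^\infty$ the space of bounded holomorphic functions on $\mathbb D$ with the supremum norm. For $b\in H^\infty$ with $\|b\|_\infty\le 1$ let $T_b$ be the operator of multiplication by $b$ on $H^2$ and $T_{\bar b}=T_b^*$. The de Branges–Rovnyak space $\mathcal H(b)$ is the range of $(I-T_bT_{\bar b})^{1/2}$ with the inner product determined by $$\big\langle (I-T_bT_{\bar b})^{1/2}f,\,(I-T_bT_{\bar b})^{1/2}g\big\rangle_b=\langle f,g\rangle_{H^2},\qquad f,g\in\big(\ker (I-T_bT_{\bar b})^{1/2}\big)^\perp .$$ Let $S$ be the operator of multiplication by $z$ on $H^2$ and $S^*$ its adjoint on $H^2$. **Proposition 3.2.** Let $b$ be a nonconstant function in the closed unit ball of $H^\infty$ that is not an extreme point of this ball, and let $a$ be its pythagorean mate, that is, the outer function on $\mathbb D$ with $a(0)>0$ and $|a|^2+|b|^2=1$ almost everywhere on $\mathbb T$ (in terms of radial boundary values). Then $S\mathcal H(b)\subseteq\mathcal H(b)$, the restriction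 $T=S|_{\mathcal H(b)}$ is a bounded operator on $\mathcal H(b)$, and $S^*b\in\mathcal H(b)$. Moreover the defect operator $\Delta_T=T^*T-I$, where $T^*$ is the adjoint with respect to $\langle\cdot,\cdot\rangle_b$, has rank one, its range is spanned by $S^*b$, and it has exactly one nonzero eigenvalue, namely $|a(0)|^{-2}\,\|S^*b\|_b^2$. -/

import Mathlib

open Complex MeasureTheory Filter Topology
open scoped Complex.UnitDisc

noncomputable section

namespace DBR

/-! ### Functions on the open unit disc -/

/-- Holomorphic functions on the open unit disc `𝔻`. -/
def IsHolo (f : 𝔻 → ℂ) : Prop :=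
  ∃ F : ℂ → ℂ, DifferentiableOn ℂ F (Metric.ball 0 1) ∧ ∀ z : 𝔻, f z = F z

/-- The space `H^∞` of bounded holomorphic functions on the disc. -/
def HInf : Submodule ℂ (𝔻 → ℂ) where
  carrier := {f | IsHolo f ∧ ∃ M : ℝ, ∀ z, ‖f z‖ ≤ M}
  add_mem' := by
    rintro f g ⟨⟨F, hF, hfF⟩, M, hM⟩ ⟨⟨G, hG, hgG⟩, N, hN⟩
    refine ⟨⟨F + G, hF.add hG, fun z => by simp [hfF, hgG]⟩, M + N, fun z => ?_⟩
    exact (norm_add_le _ _).trans (add_le_add (hM z) (hN z))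
  zero_mem' := ⟨⟨0, differentiableOn_const 0, fun z => rfl⟩, 0, fun z => by simp⟩
  smul_mem' := by
    rintro c f ⟨⟨F, hF, hfF⟩, M, hM⟩
    refine ⟨⟨c • F, hF.const_smul c, fun z => by simp [hfF]⟩, ‖c‖ * M, fun z => ?_⟩
    rw [Pi.smul_apply, norm_smul]
    exact mul_le_mul_of_nonneg_left (hM z) (norm_nonneg c)

/-- The closed unit ball of `H^∞` for the supremum norm. -/
def HInf.unitBall : Set HInf := {b | ∀ z : 𝔻, ‖(b : 𝔻 → ℂ) z‖ ≤ 1}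

/-- The coordinate function `z`, as an element of `H^∞`. -/
def HInf.coord : HInf :=
  ⟨fun z => (z : ℂ), ⟨id, differentiableOn_id, fun _ => rfl⟩, 1, fun z => z.norm_lt_one.le⟩

/-- `f` has radial limit `l` at the point `exp (i t)` of the unit circle, that is, `f (r exp (i t))`
tends to `l` as `r` increases to `1`. (The function is extended by `0` outside the disc; this has no
influence on the limit.) -/
def HasRadialLimit (f : 𝔻 → ℂ) (t : ℝ) (l : ℂ) : Prop :=
  Tendsto (fun r : ℝ =>
    if h : ‖(r : ℂ) * exp (t * I)‖ < 1 then f (UnitDisc.mk _ h) else 0) (𝓝[<] 1) (𝓝 l)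

/-- Outer functions: `a (z) = c * exp ((1 / 2π) ∫ (e^{it} + z) / (e^{it} - z) log φ(t) dt)` where
`|c| = 1`, `φ > 0` and `log φ` is integrable over the circle. -/
def IsOuter (a : 𝔻 → ℂ) : Prop :=
  ∃ (c : ℂ) (φ : ℝ → ℝ), ‖c‖ = 1 ∧ (∀ t, 0 < φ t) ∧
    IntervalIntegrable (fun t => Real.log (φ t)) volume 0 (2 * Real.pi) ∧
    ∀ z : 𝔻, a z = c * exp ((1 / (2 * Real.pi)) *
      ∫ t in (0 : ℝ)..(2 * Real.pi),
        (exp (t * I) + z) / (exp (t * I) - z) * (Real.log (φ t) : ℂ))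

/-- `a` is the pythagorean mate of `b`: `a` is outer, `a (0) > 0`, and `|a|² + |b|² = 1` almost
everywhere on the unit circle, for the (radial) boundary values of `a` and `b`. -/
structure IsPythagoreanMate (b a : 𝔻 → ℂ) : Prop where
  outer : IsOuter a
  apply_zero_pos : ∃ x : ℝ, 0 < x ∧ a 0 = x
  norm_sq_add_norm_sq : ∀ᵐ t : ℝ, ∃ α β : ℂ,
    HasRadialLimit a t α ∧ HasRadialLimit b t β ∧ ‖α‖ ^ 2 + ‖β‖ ^ 2 = 1

/-! ### The Hardy space `H²` -/

/-- The Hardy space `H²` of the disc. The function `∑ aₙ zⁿ` is given by its sequence of Taylor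
coefficients, an element of `ℓ²`; the inner product is that of the coefficients. -/
abbrev H2 : Type := lp (fun _ : ℕ => ℂ) 2

/-- The holomorphic function on the disc with the given Taylor coefficients. -/
def H2.eval (f : H2) (z : 𝔻) : ℂ := ∑' n : ℕ, f n * (z : ℂ) ^ n

/-- The constant function `1`. -/
def H2.one : H2 := lp.single 2 0 1

theorem H2.norm_coeff_le (f : H2) (n : ℕ) : ‖f n‖ ≤ ‖f‖ :=
  lp.norm_apply_le_norm (by norm_num) f n

theorem H2.summable_norm (f : H2) {r : ℝ} (h0 : 0 ≤ r) (h1 : r < 1) :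
    Summable fun n => ‖f n‖ * r ^ n := by
  refine Summable.of_nonneg_of_le (fun n => by positivity)
    (fun n => mul_le_mul_of_nonneg_right (H2.norm_coeff_le f n) (by positivity))
    ((summable_geometric_of_lt_one h0 h1).mul_left ‖f‖)

theorem H2.hasSum_eval (f : H2) (z : 𝔻) :
    HasSum (fun n => f n * (z : ℂ) ^ n) (f.eval z) := by
  refine (Summable.of_norm ?_).hasSum
  simpa using H2.summable_norm f (norm_nonneg (z : ℂ)) z.norm_lt_one

/-- A convergent power series on the disc determines its coefficients. -/
theorem coeff_unique {c d : ℕ → ℂ} {g : 𝔻 → ℂ}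
    (hc : ∀ z : 𝔻, HasSum (fun n => c n * (z : ℂ) ^ n) (g z))
    (hd : ∀ z : 𝔻, HasSum (fun n => d n * (z : ℂ) ^ n) (g z)) : c = d := by
  classical
  let G : ℂ → ℂ := fun w => if h : ‖w‖ < 1 then g (UnitDisc.mk w h) else 0
  have key : ∀ e : ℕ → ℂ, (∀ z : 𝔻, HasSum (fun n => e n * (z : ℂ) ^ n) (g z)) →
      HasFPowerSeriesAt G (FormalMultilinearSeries.ofScalars ℂ e) 0 := by
    intro e he
    refine ⟨ENNReal.ofReal 2⁻¹, ?_, by norm_num, ?_⟩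
    · have h2 : ‖((2⁻¹ : ℝ) : ℂ)‖ < 1 := by norm_num
      have hs := (he (UnitDisc.mk _ h2)).summable.norm
      refine FormalMultilinearSeries.le_radius_of_summable_norm (r := (2⁻¹ : NNReal)) _ ?_ |>.trans' ?_
      · refine hs.congr fun n => ?_
        simp
      · simp [ENNReal.ofReal, Real.toNNReal_inv]
    · intro y hy
      have hy' : ‖y‖ < 1 := by
        rw [Metric.eball_ofReal, mem_ball_zero_iff] at hy
        linarith [show (2⁻¹ : ℝ) < 1 by norm_num]
      have := he (UnitDisc.mk y hy')
      simpa [G, hy', FormalMultilinearSeries.ofScalars_apply_eq, smul_eq_mul, mul_comm] using this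
  have h := (key c hc).eq_formalMultilinearSeries (key d hd)
  exact FormalMultilinearSeries.ofScalars_series_injective ℂ ℂ h

theorem H2.eval_add (f g : H2) (z : 𝔻) : (f + g).eval z = f.eval z + g.eval z := by
  refine HasSum.tsum_eq ?_
  simpa [add_mul] using (H2.hasSum_eval f z).add (H2.hasSum_eval g z)

theorem H2.eval_smul (k : ℂ) (f : H2) (z : 𝔻) : (k • f).eval z = k * f.eval z := by
  refine HasSum.tsum_eq ?_
  simpa [mul_assoc] using (H2.hasSum_eval f z).mul_left k

theorem H2.eval_one (z : 𝔻) : H2.one.eval z = 1 := by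
  rw [H2.eval, tsum_eq_single 0]
  · simp [H2.one]
  · intro n hn
    simp [H2.one, lp.single_apply, hn]

theorem H2.eval_injective : Function.Injective H2.eval := by
  intro f g h
  apply lp.ext
  exact coeff_unique (H2.hasSum_eval f) (fun z => by rw [h]; exact H2.hasSum_eval g z)

/-- Parseval's identity for an absolutely convergent one-sided Fourier series. -/
theorem parseval {c : ℕ → ℂ} (hc : Summable fun n => ‖c n‖) :
    ∃ u : C(AddCircle (1 : ℝ), ℂ), (∀ x, HasSum (fun n : ℕ => c n * fourier n x) (u x)) ∧
      HasSum (fun n => ‖c n‖ ^ 2)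
        (‖ContinuousMap.toLp (E := ℂ) 2 AddCircle.haarAddCircle ℂ u‖ ^ 2) := by
  have hs : Summable fun n : ℕ => c n • (fourier n : C(AddCircle (1 : ℝ), ℂ)) := by
    refine Summable.of_norm ?_
    simpa [norm_smul, fourier_norm] using hc
  refine ⟨∑' n : ℕ, c n • (fourier n : C(AddCircle (1 : ℝ), ℂ)), fun x => ?_, ?_⟩
  · have := (ContinuousMap.evalCLM ℂ x).hasSum hs.hasSum
    simpa using this
  · have h1 := (ContinuousMap.toLp (E := ℂ) 2 AddCircle.haarAddCircle ℂ).hasSum hs.hasSum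
    have h2 := ((continuous_norm.pow 2).tendsto _).comp h1
    refine Tendsto.congr (fun s => ?_) h2
    have ho : Orthonormal ℂ (fun n : ℕ => fourierLp (T := (1 : ℝ)) 2 (n : ℤ)) :=
      orthonormal_fourier.comp _ Nat.cast_injective
    have h3 := ho.inner_sum c c s
    have h4 : ‖∑ n ∈ s, c n • fourierLp (T := (1 : ℝ)) 2 (n : ℤ)‖ ^ 2 = ∑ n ∈ s, ‖c n‖ ^ 2 := by
      rw [← inner_self_eq_norm_sq (𝕜 := ℂ), h3]
      simp [← Complex.normSq_eq_conj_mul_self, Complex.normSq_eq_norm_sq, -Complex.ofReal_pow]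
    rw [← h4]
    simp [fourierLp]

theorem sum_le_of_norm_le {c d : ℕ → ℂ} (hc : Summable fun n => ‖c n‖)
    (hd : Summable fun n => ‖d n‖) {M : ℝ}
    (h : ∀ (x : AddCircle (1 : ℝ)) (u v : ℂ), HasSum (fun n : ℕ => c n * fourier n x) u →
      HasSum (fun n : ℕ => d n * fourier n x) v → ‖u‖ ≤ M * ‖v‖) (s : Finset ℕ) :
    ∑ n ∈ s, ‖c n‖ ^ 2 ≤ M ^ 2 * ∑' n, ‖d n‖ ^ 2 := by
  obtain ⟨u, hu, hu2⟩ := parseval hc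
  obtain ⟨v, hv, hv2⟩ := parseval hd
  rw [hv2.tsum_eq]
  refine (sum_le_hasSum s (fun n _ => by positivity) hu2).trans ?_
  rw [← mul_pow]
  refine pow_le_pow_left₀ (norm_nonneg _) (Lp.norm_le_mul_norm_of_ae_le_mul ?_) 2
  filter_upwards [ContinuousMap.coeFn_toLp (E := ℂ) (p := 2) (𝕜 := ℂ) AddCircle.haarAddCircle u,
    ContinuousMap.coeFn_toLp (E := ℂ) (p := 2) (𝕜 := ℂ) AddCircle.haarAddCircle v] with x hx hy
  rw [hx, hy]
  exact h x _ _ (hu x) (hv x)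

/-- The product of a bounded holomorphic function and a function in `H²` is in `H²`. -/
theorem exists_mul (b : HInf) {M : ℝ} (hM : ∀ z, ‖(b : 𝔻 → ℂ) z‖ ≤ M) (f : H2) :
    ∃ g : H2, (∀ z, g.eval z = (b : 𝔻 → ℂ) z * f.eval z) ∧ ‖g‖ ≤ M * ‖f‖ := by
  have hM0 : 0 ≤ M := (norm_nonneg _).trans (hM 0)
  obtain ⟨B, hB, hbB⟩ := b.2.1
  -- the Taylor coefficients of the product
  obtain ⟨e, he⟩ : ∃ e : ℕ → ℂ, ∀ z : 𝔻, HasSum (fun n => e n * (z : ℂ) ^ n) (B z) := by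
    refine ⟨fun n => (n.factorial : ℂ)⁻¹ * iteratedDeriv n B 0, fun z => ?_⟩
    have := Complex.hasSum_taylorSeries_on_ball (r := 1) (by simpa using hB)
      (z := (z : ℂ)) (by simpa using z.norm_lt_one)
    simpa [smul_eq_mul, mul_comm, mul_assoc, mul_left_comm] using this
  let c : ℕ → ℂ := fun n => ∑ kl ∈ Finset.HasAntidiagonal.antidiagonal n, e kl.1 * f kl.2
  have hc : ∀ z : 𝔻, (Summable fun n => ‖c n * (z : ℂ) ^ n‖) ∧
      HasSum (fun n => c n * (z : ℂ) ^ n) ((b : 𝔻 → ℂ) z * f.eval z) := by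
    intro z
    have h1 := (he z).summable.norm
    have h2 := (H2.hasSum_eval f z).summable.norm
    have h3 : (fun n => ∑ kl ∈ Finset.HasAntidiagonal.antidiagonal n,
        (e kl.1 * (z : ℂ) ^ kl.1) * (f kl.2 * (z : ℂ) ^ kl.2)) = fun n => c n * (z : ℂ) ^ n := by
      funext n
      simp only [c, Finset.sum_mul]
      refine Finset.sum_congr rfl fun kl hkl => ?_
      rw [← Finset.HasAntidiagonal.mem_antidiagonal.1 hkl, pow_add]
      ring
    have h4 := summable_norm_sum_mul_antidiagonal_of_summable_norm h1 h2
    simp_rw [congrFun h3] at h4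
    refine ⟨h4, ?_⟩
    have h5 := tsum_mul_tsum_eq_tsum_sum_antidiagonal_of_summable_norm h1 h2
    rw [h3] at h5
    rw [hbB, ← (he z).tsum_eq, ← (H2.hasSum_eval f z).tsum_eq, h5]
    exact h4.of_norm.hasSum
  have hfn : HasSum (fun n => ‖f n‖ ^ 2) (‖f‖ ^ 2) := by
    have := lp.hasSum_norm (p := 2) (by norm_num) f
    simpa using this
  -- the estimate on circles of radius `r < 1`
  have hr : ∀ r : ℝ, 0 < r → r < 1 → ∀ s : Finset ℕ,
      ∑ n ∈ s, (‖c n‖ * r ^ n) ^ 2 ≤ (M * ‖f‖) ^ 2 := by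
    intro r h0 h1 s
    have hz : ∀ w : Circle, ‖(r : ℂ) * w‖ < 1 := fun w => by
      simpa only [norm_mul, Circle.norm_coe, Complex.norm_real, Real.norm_eq_abs, abs_of_pos h0,
        mul_one] using h1
    have hcs : Summable fun n => ‖c n * (r : ℂ) ^ n‖ := by
      simpa using (hc (UnitDisc.mk _ (hz 1))).1
    have hfs : Summable fun n => ‖f n * (r : ℂ) ^ n‖ := by
      simpa [abs_of_pos h0] using H2.summable_norm f h0.le h1
    have hmain := sum_le_of_norm_le (M := M) hcs hfs (fun x u v hu hv => by
      have hz' := hz (AddCircle.toCircle x)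
      have e1 : ∀ n : ℕ, (fourier (n : ℤ) x : ℂ) = (AddCircle.toCircle x : ℂ) ^ n := by
        intro n
        rw [fourier_apply, ← Circle.coe_pow, ← AddCircle.toCircle_nsmul]
        simp
      have h1 := (hc (UnitDisc.mk _ hz')).2
      have h2 := H2.hasSum_eval f (UnitDisc.mk _ hz')
      simp only [UnitDisc.coe_mk, mul_pow] at h1 h2
      simp only [e1, mul_assoc] at hu hv
      rw [hu.unique h1, hv.unique h2, norm_mul]
      exact mul_le_mul_of_nonneg_right (hM _) (norm_nonneg _)) s
    refine le_trans (le_of_eq ?_) (hmain.trans ?_)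
    · refine Finset.sum_congr rfl fun n _ => ?_
      simp [abs_of_pos h0]
    · rw [mul_pow, ← hfn.tsum_eq]
      refine mul_le_mul_of_nonneg_left ?_ (by positivity)
      have hle : ∀ n, ‖f n * (r : ℂ) ^ n‖ ^ 2 ≤ ‖f n‖ ^ 2 := fun n => by
        refine pow_le_pow_left₀ (norm_nonneg _) ?_ 2
        simpa [abs_of_pos h0] using
          mul_le_of_le_one_right (norm_nonneg (f n)) (pow_le_one₀ h0.le h1.le)
      exact Summable.tsum_le_tsum hle
        (Summable.of_nonneg_of_le (fun n => by positivity) hle hfn.summable) hfn.summable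
  have hfin : ∀ s : Finset ℕ, ∑ n ∈ s, ‖c n‖ ^ 2 ≤ (M * ‖f‖) ^ 2 := by
    intro s
    have ht : Tendsto (fun r : ℝ => ∑ n ∈ s, (‖c n‖ * r ^ n) ^ 2) (𝓝[<] 1)
        (𝓝 (∑ n ∈ s, ‖c n‖ ^ 2)) := by
      have : Continuous fun r : ℝ => ∑ n ∈ s, (‖c n‖ * r ^ n) ^ 2 := by fun_prop
      simpa using (this.tendsto 1).mono_left nhdsWithin_le_nhds
    refine le_of_tendsto ht ?_
    filter_upwards [Ioo_mem_nhdsLT (show (0 : ℝ) < 1 by norm_num)] with r hr'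
    exact hr r hr'.1 hr'.2 s
  have hmem : Memℓp c 2 := memℓp_gen' (C := (M * ‖f‖) ^ 2) (by simpa using hfin)
  refine ⟨⟨c, hmem⟩, fun z => (hc z).2.tsum_eq, ?_⟩
  refine lp.norm_le_of_forall_sum_le (by norm_num) (by positivity) (fun s => ?_)
  simpa using hfin s

/-- The Toeplitz operator `T_b` with symbol `b ∈ H^∞`: multiplication by `b` on `H²`. -/
def toeplitz (b : HInf) : H2 →L[ℂ] H2 :=
  LinearMap.mkContinuousOfExistsBound
    { toFun := fun f => (exists_mul b b.2.2.choose_spec f).choose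
      map_add' := fun f g => H2.eval_injective (by
        funext z
        have h := fun f : H2 => (exists_mul b b.2.2.choose_spec f).choose_spec.1 z
        rw [h, H2.eval_add, H2.eval_add, h, h, mul_add])
      map_smul' := fun k f => H2.eval_injective (by
        funext z
        have h := fun f : H2 => (exists_mul b b.2.2.choose_spec f).choose_spec.1 z
        rw [h, RingHom.id_apply, H2.eval_smul, H2.eval_smul, h, mul_left_comm]) }
    ⟨b.2.2.choose, fun f => (exists_mul b b.2.2.choose_spec f).choose_spec.2⟩

theorem toeplitz_eval (b : HInf) (f : H2) (z : 𝔻) :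
    (toeplitz b f).eval z = (b : 𝔻 → ℂ) z * f.eval z :=
  (exists_mul b b.2.2.choose_spec f).choose_spec.1 z

/-- The shift `S` on `H²`, that is, multiplication by `z`. -/
def shift : H2 →L[ℂ] H2 := toeplitz HInf.coord

/-- A bounded holomorphic function as an element of `H²`, namely `b = T_b 1`. -/
def HInf.toH2 (b : HInf) : H2 := toeplitz b H2.one

theorem HInf.toH2_eval (b : HInf) (z : 𝔻) : (HInf.toH2 b).eval z = (b : 𝔻 → ℂ) z := by
  rw [HInf.toH2, toeplitz_eval, H2.eval_one, mul_one]

/-! ### Operator ranges and de Branges-Rovnyak spaces -/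

section RangeSpace

variable {E F : Type} [NormedAddCommGroup E] [InnerProductSpace ℂ E] [CompleteSpace E]
  [NormedAddCommGroup F] [InnerProductSpace ℂ F]

/-- The range of a bounded operator `A`, to be endowed with the inner product
`⟨A f, A g⟩ = ⟨f, g⟩` for `f, g ∈ (ker A)ᗮ`. -/
def RangeSpace (A : E →L[ℂ] F) : Type := ↥(LinearMap.range A.toLinearMap)

namespace RangeSpace

variable (A : E →L[ℂ] F)

instance : AddCommGroup (RangeSpace A) :=
  inferInstanceAs (AddCommGroup ↥(LinearMap.range A.toLinearMap))

instance : Module ℂ (RangeSpace A) :=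
  inferInstanceAs (Module ℂ ↥(LinearMap.range A.toLinearMap))

/-- The inclusion of the range into the ambient space. -/
def incl : RangeSpace A →ₗ[ℂ] F := (LinearMap.range A.toLinearMap).subtype

instance : CompleteSpace (LinearMap.ker A.toLinearMap) :=
  (show IsClosed (LinearMap.ker A.toLinearMap : Set E) from A.isClosed_ker).completeSpace_coe

/-- The linear bijection from `(ker A)ᗮ` onto the range of `A` that `A` induces. -/
def equiv : (LinearMap.ker A.toLinearMap)ᗮ ≃ₗ[ℂ] RangeSpace A :=
  LinearMap.kerComplementEquivRange A.toLinearMap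
    (Submodule.isCompl_orthogonal _).symm

theorem incl_equiv (f : (LinearMap.ker A.toLinearMap)ᗮ) : incl A (equiv A f) = A f := rfl

/-- The inner product `⟨A f, A g⟩ = ⟨f, g⟩` for `f, g ∈ (ker A)ᗮ`. -/
abbrev core : InnerProductSpace.Core ℂ (RangeSpace A) where
  inner x y := inner ℂ ((equiv A).symm x) ((equiv A).symm y)
  conj_inner_symm x y := inner_conj_symm _ _
  re_inner_nonneg x := inner_self_nonneg
  add_left x y z := by rw [map_add, inner_add_left]
  smul_left x y r := by rw [map_smul, inner_smul_left]
  definite x h := by simpa using h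

instance : NormedAddCommGroup (RangeSpace A) := (core A).toNormedAddCommGroup

instance : InnerProductSpace ℂ (RangeSpace A) := InnerProductSpace.ofCore (core A).toCore

theorem inner_equiv (f g : (LinearMap.ker A.toLinearMap)ᗮ) :
    inner ℂ (equiv A f) (equiv A g) = inner ℂ (f : E) (g : E) := by
  change inner ℂ ((equiv A).symm (equiv A f)) ((equiv A).symm (equiv A g)) = _
  simp

/-- `A` is a Hilbert space isomorphism of `(ker A)ᗮ` with its range space. -/
def isometryEquiv : (LinearMap.ker A.toLinearMap)ᗮ ≃ₗᵢ[ℂ] RangeSpace A :=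
  (equiv A).isometryOfInner (inner_equiv A)

instance : CompleteSpace (RangeSpace A) :=
  (isometryEquiv A).toIsometryEquiv.completeSpace_iff.1 inferInstance

end RangeSpace

end RangeSpace

/-- The positive square root of a positive bounded operator on a Hilbert space. -/
def posSqrt {H : Type} [NormedAddCommGroup H] [InnerProductSpace ℂ H] [CompleteSpace H]
    (A : H →L[ℂ] H) : H →L[ℂ] H :=
  CFC.sqrt A

/-- The operator `(I - T_b T_b^*)^{1/2}` on `H²`; here `T_b^*` is the Toeplitz operator with symbol
the complex conjugate of `b`. -/
def defectRoot (b : HInf) : H2 →L[ℂ] H2 :=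
  posSqrt (1 - toeplitz b * ContinuousLinearMap.adjoint (toeplitz b))

/-- The de Branges-Rovnyak space `H(b)`: the range of `(I - T_b T_b^*)^{1/2}` with the range norm. -/
abbrev HSpace (b : HInf) : Type := RangeSpace (defectRoot b)

/-- The inclusion of `H(b)` into `H²`. -/
abbrev HSpace.incl (b : HInf) : HSpace b →ₗ[ℂ] H2 := RangeSpace.incl (defectRoot b)

/-- The defect operator `T^* T - I` of a bounded operator `T` on a Hilbert space. -/
def defect {H : Type} [NormedAddCommGroup H] [InnerProductSpace ℂ H] [CompleteSpace H]
    (T : H →L[ℂ] H) : H →L[ℂ] H :=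
  ContinuousLinearMap.adjoint T * T - 1

end DBR

end

open DBR

noncomputable section

namespace DBR

/-! ### Range spaces -/

/-! Write P_b = T_b T_b* and let `e` be the constant function 1. The idea is to replace H(b) by a
concrete space of pairs on which the shift can be computed. From |a|² + |b|² = 1 on the circle one
gets T_a* T_a + T_b* T_b = I (`adjoint_toeplitz_add`), and since a is outer, aH² is dense, so T_a*
is injective (`adjoint_toeplitz_injective`). Let M be the space of pairs (f, g) in H² ⊕ H² with T_b*
f = T_a* g. The projection P(f, g) = f is injective on M and P P* = I - P_b. An operator range with
its range norm depends only on the product of the operator with its adjoint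
(`RangeSpace.exists_isometryEquiv`), so P is a unitary map of M onto H(b). The adjoint of a Toeplitz
operator commutes with S up to the rank one term ⟨S*b, ·⟩e. Hence (Sf, Sg) need not lie in M, but
(Sf, Sg + ce) does for exactly one c, because T_a* e is a nonzero multiple of e. With u = (S*b,
-S*a), which lies in M, this is c = ⟨u, (f, g)⟩ divided by the conjugate of a(0). Since S is
isometric with range orthogonal to e, T increases the squared norm by |c|², that is, T*T - I =
|a(0)|⁻² ⟨u, ·⟩ u. As u corresponds to S*b, and S*b ≠ 0 for nonconstant b, the range and the nonzero
eigenvalue can be read off. The analytic input is the operator identity, from Parseval on circles of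
radius r < 1 and dominated convergence as r → 1, and the facts that a is bounded by 1 and that aH²
is dense, both from truncating log |a| in the outer representation. -/

theorem denseRange_of_forall_inner {E F : Type} [AddCommGroup E] [Module ℂ E]
    [NormedAddCommGroup F] [InnerProductSpace ℂ F] [CompleteSpace F] (f : E →ₗ[ℂ] F)
    (h : ∀ y, (∀ x, (inner ℂ (f x) y : ℂ) = 0) → y = 0) : DenseRange f := by
  have : (LinearMap.range f).topologicalClosure = ⊤ := by
    rw [Submodule.topologicalClosure_eq_top_iff, Submodule.eq_bot_iff]
    exact fun y hy => h y fun x => hy _ ⟨x, rfl⟩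
  exact Submodule.dense_iff_topologicalClosure_eq_top.2 this

namespace RangeSpace

variable {E F K : Type} [NormedAddCommGroup E] [InnerProductSpace ℂ E]
  [NormedAddCommGroup F] [InnerProductSpace ℂ F]
  [NormedAddCommGroup K] [InnerProductSpace ℂ K] [CompleteSpace K]

theorem incl_injective (A : E →L[ℂ] F) : Function.Injective (incl A) :=
  Subtype.val_injective

variable [CompleteSpace E]

theorem incl_eq (A : E →L[ℂ] F) (x : RangeSpace A) :
    incl A x = A ((isometryEquiv A).symm x) := by
  conv_lhs => rw [← (isometryEquiv A).apply_symm_apply x]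
  exact incl_equiv A _

theorem continuous_incl (A : E →L[ℂ] F) : Continuous (incl A) := by
  rw [show ⇑(incl A) = fun x => A ((isometryEquiv A).symm x) from funext (incl_eq A)]
  fun_prop

variable [CompleteSpace F]

/-- The map `x ↦ A A* x` into the range space of `A`. -/
def adjointMap (A : E →L[ℂ] F) : F →ₗ[ℂ] RangeSpace A where
  toFun x := isometryEquiv A ⟨ContinuousLinearMap.adjoint A x, fun y hy => by
    rw [ContinuousLinearMap.adjoint_inner_right, show A y = 0 from hy, inner_zero_left]⟩
  map_add' x y := by
    rw [← map_add]; congr 1; ext; simp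
  map_smul' c x := by
    rw [RingHom.id_apply, ← map_smul]; congr 1; ext; simp

theorem norm_adjointMap (A : E →L[ℂ] F) (x : F) :
    ‖adjointMap A x‖ = ‖ContinuousLinearMap.adjoint A x‖ :=
  (isometryEquiv A).norm_map _

theorem incl_adjointMap (A : E →L[ℂ] F) (x : F) :
    incl A (adjointMap A x) = A (ContinuousLinearMap.adjoint A x) := rfl

/-- The reproducing property of the range space: A A* x represents the functional pairing the
inclusion with x, which is why A A* determines the whole structure. -/
theorem inner_adjointMap (A : E →L[ℂ] F) (x : F) (y : RangeSpace A) :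
    inner ℂ (adjointMap A x) y = inner ℂ x (incl A y) := by
  obtain ⟨y, rfl⟩ := (isometryEquiv A).surjective y
  rw [adjointMap, LinearMap.coe_mk, AddHom.coe_mk, LinearIsometryEquiv.inner_map_map]
  change inner ℂ (ContinuousLinearMap.adjoint A x) (y : E) = inner ℂ x (A y)
  rw [ContinuousLinearMap.adjoint_inner_left]

theorem denseRange_adjointMap (A : E →L[ℂ] F) : DenseRange (adjointMap A) := by
  refine denseRange_of_forall_inner _ fun y hy => incl_injective A ?_
  rw [map_zero]
  refine ext_inner_left ℂ fun x => ?_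
  rw [← inner_adjointMap, inner_zero_right, hy]

/-- If `A A* = B B*` and `B` is injective, then `B` is a unitary map onto the range space of `A`. -/
theorem exists_isometryEquiv (A : E →L[ℂ] F) (B : K →L[ℂ] F) (hB : Function.Injective B)
    (h : ∀ x, A (ContinuousLinearMap.adjoint A x) = B (ContinuousLinearMap.adjoint B x)) :
    ∃ Φ : K ≃ₗᵢ[ℂ] RangeSpace A, ∀ k, incl A (Φ k) = B k := by
  have hd : DenseRange (ContinuousLinearMap.adjoint B).toLinearMap := by
    refine denseRange_of_forall_inner _ fun y hy => hB ?_
    rw [map_zero]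
    refine ext_inner_left ℂ fun x => ?_
    rw [← ContinuousLinearMap.adjoint_inner_left, inner_zero_right]
    exact hy x
  -- Both squared norms equal ⟨x, A A* x⟩ = ⟨x, B B* x⟩, so B* x ↦ A A* x is isometric between dense
  -- subspaces and extends to the unitary map sought.
  have hn : ∀ x, ‖adjointMap A (LinearEquiv.refl ℂ F x)‖
      = ‖(ContinuousLinearMap.adjoint B).toLinearMap x‖ := by
    intro x
    have key : ∀ {G : Type} [NormedAddCommGroup G] [InnerProductSpace ℂ G] [CompleteSpace G]
        (C : G →L[ℂ] F), ((‖ContinuousLinearMap.adjoint C x‖ : ℂ)) ^ 2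
          = inner ℂ x (C (ContinuousLinearMap.adjoint C x)) := by
      intro G _ _ _ C
      rw [← ContinuousLinearMap.adjoint_inner_left, inner_self_eq_norm_sq_to_K]
      rfl
    have h2 := key A
    rw [h x, ← key B] at h2
    rw [LinearEquiv.refl_apply, norm_adjointMap]
    have h3 : ‖ContinuousLinearMap.adjoint A x‖ ^ 2 = ‖ContinuousLinearMap.adjoint B x‖ ^ 2 := by
      exact_mod_cast h2
    exact (pow_left_inj₀ (norm_nonneg _) (norm_nonneg _) two_ne_zero).1 h3
  refine ⟨(LinearEquiv.refl ℂ F).extendOfIsometry _ (adjointMap A) hd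
    (denseRange_adjointMap A) hn, fun k => ?_⟩
  refine hd.induction_on (p := fun k => incl A ((LinearEquiv.refl ℂ F).extendOfIsometry _
    (adjointMap A) hd (denseRange_adjointMap A) hn k) = B k) k ?_ fun x => ?_
  · exact isClosed_eq ((continuous_incl A).comp (LinearIsometryEquiv.continuous _)) B.continuous
  · rw [LinearEquiv.extendOfIsometry_eq, LinearEquiv.refl_apply, incl_adjointMap, h]
    rfl

end RangeSpace

/-! ### The model space of a pair -/

section Model

variable {H : Type} [NormedAddCommGroup H] [InnerProductSpace ℂ H] [CompleteSpace H]

/-- Operators `A` and `B` that commute with a shift `S` with wandering vector `e` and satisfy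
`A* A + B* B = 1`, where `A*` is injective and has eigenvector `e`. -/
structure IsMatePair (S A B : H →L[ℂ] H) (e : H) (κ : ℂ) : Prop where
  adjoint_shift_shift : ∀ x, ContinuousLinearMap.adjoint S (S x) = x
  adjoint_shift_vector : ContinuousLinearMap.adjoint S e = 0
  inner_vector : inner ℂ e e = (1 : ℂ)
  shift_adjoint_shift : ∀ x, S (ContinuousLinearMap.adjoint S x) + (inner ℂ e x : ℂ) • e = x
  comm_left : ∀ x, A (S x) = S (A x)
  comm_right : ∀ x, B (S x) = S (B x)
  add_eq : ∀ x, ContinuousLinearMap.adjoint A (A x) + ContinuousLinearMap.adjoint B (B x) = x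
  adjoint_vector : ContinuousLinearMap.adjoint A e = κ • e
  ne_zero : κ ≠ 0
  injective : Function.Injective (ContinuousLinearMap.adjoint A)

/-- The map `(f, g) ↦ B* f - A* g`. -/
abbrev modelMap (A B : H →L[ℂ] H) : WithLp 2 (H × H) →L[ℂ] H :=
  ContinuousLinearMap.adjoint B ∘L WithLp.fstL 2 ℂ H H -
    ContinuousLinearMap.adjoint A ∘L WithLp.sndL 2 ℂ H H

/-- The space of pairs `(f, g)` with `B* f = A* g`. -/
abbrev Model (A B : H →L[ℂ] H) : Type := ↥(LinearMap.ker (modelMap A B).toLinearMap)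

namespace Model

variable {S A B : H →L[ℂ] H} {e : H} {κ : ℂ}

theorem mem_iff (x : WithLp 2 (H × H)) : x ∈ LinearMap.ker (modelMap A B).toLinearMap ↔
    ContinuousLinearMap.adjoint B x.fst = ContinuousLinearMap.adjoint A x.snd := by
  rw [LinearMap.mem_ker]
  exact sub_eq_zero

/-- The projection of the model space to the first component. -/
def proj (A B : H →L[ℂ] H) : Model A B →L[ℂ] H :=
  WithLp.fstL 2 ℂ H H ∘L Submodule.subtypeL _

/-- Injectivity of A* makes the second component a function of the first. -/
theorem proj_injective (h : IsMatePair S A B e κ) : Function.Injective (proj A B) := by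
  rw [injective_iff_map_eq_zero]
  rintro ⟨x, hx⟩ h0
  have h1 : x.fst = 0 := h0
  rw [mem_iff, h1, map_zero] at hx
  have h2 : x.snd = 0 := h.injective (by rw [← hx, map_zero])
  ext1
  refine (WithLp.equiv 2 (H × H)).injective (Prod.ext h1 h2)

/-- The adjoint of the projection sends x to (x - B B* x, A B* x). This pair lies in the model space
because A* A + B* B = 1, applied to B* x. -/
theorem proj_adjoint (h : IsMatePair S A B e κ) (x : H) :
    proj A B (ContinuousLinearMap.adjoint (proj A B) x)
      = x - B (ContinuousLinearMap.adjoint B x) := by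
  let y : WithLp 2 (H × H) := WithLp.toLp 2
    (x - B (ContinuousLinearMap.adjoint B x), A (ContinuousLinearMap.adjoint B x))
  have hy : y ∈ LinearMap.ker (modelMap A B).toLinearMap := by
    rw [mem_iff]
    have := h.add_eq (ContinuousLinearMap.adjoint B x)
    simp only [y, WithLp.toLp_fst, WithLp.toLp_snd, map_sub]
    rw [sub_eq_iff_eq_add]
    exact this.symm
  have : ContinuousLinearMap.adjoint (proj A B) x = ⟨y, hy⟩ := by
    refine ext_inner_right ℂ fun k => ?_
    rw [ContinuousLinearMap.adjoint_inner_left]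
    obtain ⟨k, hk⟩ := k
    have hk' := (mem_iff _).1 hk
    change inner ℂ x k.fst = inner ℂ y k
    rw [WithLp.prod_inner_apply]
    simp only [y, WithLp.ofLp_fst, WithLp.ofLp_snd, inner_sub_left,
      ← ContinuousLinearMap.adjoint_inner_right]
    simp [hk']
  rw [this]
  rfl

/-- C* S is split along the range of S and the wandering vector: S* C* S = C* S* S = C* gives the
first part, and the coefficient along e is ⟨e, C* S x⟩ = ⟨S* C e, x⟩. -/
theorem adjoint_comp_shift {C : H →L[ℂ] H} (h : IsMatePair S A B e κ)
    (hC : ∀ x, C (S x) = S (C x)) (x : H) :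
    ContinuousLinearMap.adjoint C (S x) = S (ContinuousLinearMap.adjoint C x)
      + (inner ℂ (ContinuousLinearMap.adjoint S (C e)) x : ℂ) • e := by
  rw [← h.shift_adjoint_shift (ContinuousLinearMap.adjoint C (S x))]
  congr 2
  · refine (ext_inner_left ℂ fun y => ?_)
    rw [ContinuousLinearMap.adjoint_inner_right, ContinuousLinearMap.adjoint_inner_right, hC,
      ← ContinuousLinearMap.adjoint_inner_right, h.adjoint_shift_shift,
      ContinuousLinearMap.adjoint_inner_right]
  · rw [ContinuousLinearMap.adjoint_inner_right, ContinuousLinearMap.adjoint_inner_left]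

theorem adjoint_comp_adjoint_shift {C : H →L[ℂ] H} (hC : ∀ x, C (S x) = S (C x)) (x : H) :
    ContinuousLinearMap.adjoint C (ContinuousLinearMap.adjoint S x)
      = ContinuousLinearMap.adjoint S (ContinuousLinearMap.adjoint C x) := by
  refine ext_inner_left ℂ fun y => ?_
  simp only [ContinuousLinearMap.adjoint_inner_right, hC]

/-- The pair `(S* B e, - S* A e)`. -/
def vector (h : IsMatePair S A B e κ) : Model A B :=
  ⟨WithLp.toLp 2 (ContinuousLinearMap.adjoint S (B e), - ContinuousLinearMap.adjoint S (A e)), by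
    -- B* S* B e + A* S* A e = S*(B* B + A* A)e = S* e = 0.
    rw [mem_iff, WithLp.toLp_fst, WithLp.toLp_snd, map_neg,
      adjoint_comp_adjoint_shift h.comm_left, adjoint_comp_adjoint_shift h.comm_right,
      eq_neg_iff_add_eq_zero, add_comm, ← map_add, h.add_eq, h.adjoint_shift_vector]⟩

theorem inner_vector (h : IsMatePair S A B e κ) (k : Model A B) :
    inner ℂ (vector h) k = (inner ℂ (ContinuousLinearMap.adjoint S (B e)) k.1.fst : ℂ)
      - inner ℂ (ContinuousLinearMap.adjoint S (A e)) k.1.snd := by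
  change inner ℂ (vector h).1 k.1 = _
  rw [WithLp.prod_inner_apply, vector]
  simp [inner_neg_left, sub_eq_add_neg]

/-- The operator `(f, g) ↦ (S f, S g + c e)` of the model space. -/
def shiftMap (h : IsMatePair S A B e κ) : Model A B →L[ℂ] Model A B :=
  ((WithLp.prodContinuousLinearEquiv 2 ℂ H H).symm.toContinuousLinearMap ∘L
    ((S ∘L WithLp.fstL 2 ℂ H H ∘L Submodule.subtypeL _).prod
      (S ∘L WithLp.sndL 2 ℂ H H ∘L Submodule.subtypeL _
        + (κ⁻¹ • innerSL ℂ (vector h)).smulRight e))).codRestrict _ (by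
    intro k
    have hk := (mem_iff _).1 k.2
    rw [mem_iff]
    change ContinuousLinearMap.adjoint B (S k.1.fst) = ContinuousLinearMap.adjoint A
      (S k.1.snd + (κ⁻¹ * inner ℂ (vector h) k) • e)
    -- After the commutation relations both sides share S B* f = S A* g, and the coefficients of e
    -- agree precisely when κ c is the inner product with `vector h`. This dictates c.
    rw [map_add, map_smul, h.adjoint_vector, smul_smul, mul_right_comm, inv_mul_cancel₀ h.ne_zero,
      one_mul, adjoint_comp_shift h h.comm_left, adjoint_comp_shift h h.comm_right, hk,
      inner_vector, sub_smul]
    abel)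

theorem shiftMap_fst (h : IsMatePair S A B e κ) (k : Model A B) :
    (shiftMap h k).1.fst = S k.1.fst := rfl

theorem shiftMap_snd (h : IsMatePair S A B e κ) (k : Model A B) :
    (shiftMap h k).1.snd = S k.1.snd + (κ⁻¹ * inner ℂ (vector h) k) • e := rfl

/-- S is isometric and e is a unit vector orthogonal to its range, so only the product of the two
added coefficients of e survives beyond ⟨k, l⟩. -/
theorem inner_shiftMap (h : IsMatePair S A B e κ) (k l : Model A B) :
    (inner ℂ (shiftMap h k) (shiftMap h l) : ℂ) = inner ℂ k l
      + ((‖κ‖ ^ 2 : ℝ) : ℂ)⁻¹ * (inner ℂ k (vector h) * inner ℂ (vector h) l) := by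
  have h1 : ∀ x y, (inner ℂ (S x) (S y) : ℂ) = inner ℂ x y := fun x y => by
    rw [← ContinuousLinearMap.adjoint_inner_right, h.adjoint_shift_shift]
  have h2 : ∀ x, (inner ℂ e (S x) : ℂ) = 0 := fun x => by
    rw [← ContinuousLinearMap.adjoint_inner_left, h.adjoint_shift_vector, inner_zero_left]
  have h3 : ∀ x, (inner ℂ (S x) e : ℂ) = 0 := fun x => by
    rw [← ContinuousLinearMap.adjoint_inner_right, h.adjoint_shift_vector, inner_zero_right]
  change inner ℂ (shiftMap h k).1 (shiftMap h l).1 = inner ℂ k.1 l.1 + _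
  rw [WithLp.prod_inner_apply, WithLp.prod_inner_apply]
  simp only [WithLp.ofLp_fst, WithLp.ofLp_snd, shiftMap_fst, shiftMap_snd, inner_add_left,
    inner_add_right, inner_smul_left, inner_smul_right, h1, h2, h3, h.inner_vector]
  rw [← Complex.normSq_eq_norm_sq, ← Complex.mul_conj, map_mul, map_inv₀, mul_inv,
    ← inner_conj_symm k (vector h)]
  ring

end Model

end Model

/-! ### Defect operators of rank one -/

section Defect

variable {H : Type} [NormedAddCommGroup H] [InnerProductSpace ℂ H]

theorem defect_apply_of_inner [CompleteSpace H] {T : H →L[ℂ] H} {u : H} {c : ℝ}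
    (h : ∀ x y, (inner ℂ (T x) (T y) : ℂ) = inner ℂ x y + (c : ℂ) * (inner ℂ x u * inner ℂ u y))
    (y : H) : defect T y = ((c : ℂ) * inner ℂ u y) • u := by
  refine ext_inner_left ℂ fun x => ?_
  change inner ℂ x (ContinuousLinearMap.adjoint T (T y) - y) = _
  rw [inner_sub_right, ContinuousLinearMap.adjoint_inner_right, h, inner_smul_right]
  ring

theorem range_defect_of_inner {D : H →ₗ[ℂ] H} {u : H} {c : ℝ} (hc : c ≠ 0) (hu : u ≠ 0)
    (h : ∀ y, D y = ((c : ℂ) * inner ℂ u y) • u) : LinearMap.range D = Submodule.span ℂ {u} := by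
  have hc' : (c : ℂ) ≠ 0 := by exact_mod_cast hc
  have hu' : (inner ℂ u u : ℂ) ≠ 0 := inner_self_ne_zero.2 hu
  apply le_antisymm
  · rintro _ ⟨y, rfl⟩
    rw [h]
    exact Submodule.smul_mem _ _ (Submodule.mem_span_singleton_self u)
  · rw [Submodule.span_singleton_le_iff_mem]
    refine ⟨((c : ℂ) * inner ℂ u u)⁻¹ • u, ?_⟩
    rw [map_smul, h, smul_smul, inv_mul_cancel₀ (mul_ne_zero hc' hu'), one_smul]

theorem hasEigenvalue_defect_of_inner {D : H →ₗ[ℂ] H} {u : H} {c : ℝ} (hc : c ≠ 0) (hu : u ≠ 0)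
    (h : ∀ y, D y = ((c : ℂ) * inner ℂ u y) • u) (l : ℂ) :
    (l ≠ 0 ∧ Module.End.HasEigenvalue D l) ↔ l = ((c * ‖u‖ ^ 2 : ℝ) : ℂ) := by
  have hc' : (c : ℂ) ≠ 0 := by exact_mod_cast hc
  have e : ((c * ‖u‖ ^ 2 : ℝ) : ℂ) = (c : ℂ) * inner ℂ u u := by
    rw [inner_self_eq_norm_sq_to_K]
    push_cast
    rfl
  rw [e]
  constructor
  · rintro ⟨hl, hev⟩
    obtain ⟨v, hv, hv0⟩ := hev.exists_hasEigenvector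
    rw [Module.End.mem_eigenspace_iff, h] at hv
    -- Pairing with u turns the eigenvector equation into a scalar one; ⟨u, v⟩ ≠ 0, as otherwise D v
    -- = 0 and l = 0.
    have h1 := congrArg (inner ℂ u) hv
    rw [inner_smul_right, inner_smul_right] at h1
    have h2 : (inner ℂ u v : ℂ) ≠ 0 := by
      intro h0
      rw [h0, mul_zero, zero_smul] at hv
      exact (smul_ne_zero hl hv0) hv.symm
    refine mul_right_cancel₀ h2 ?_
    rw [← h1]
    ring
  · rintro rfl
    refine ⟨mul_ne_zero hc' (inner_self_ne_zero.2 hu),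
      Module.End.hasEigenvalue_of_hasEigenvector (x := u) ⟨?_, hu⟩⟩
    rw [Module.End.mem_eigenspace_iff, h]

end Defect

/-! ### The shift and Toeplitz operators in coefficients -/

theorem H2.eval_zero_point (f : H2) : f.eval 0 = f 0 := by
  rw [H2.eval, tsum_eq_single 0]
  · simp
  · intro n hn
    simp [hn]

theorem H2.add_coeff (f g : H2) (n : ℕ) : (f + g) n = f n + g n := rfl

theorem H2.smul_coeff (c : ℂ) (f : H2) (n : ℕ) : (c • f) n = c * f n := rfl

theorem H2.one_coeff_zero : H2.one 0 = 1 := by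
  simp [H2.one]

theorem H2.one_coeff_succ (n : ℕ) : H2.one (n + 1) = 0 := by
  simp [H2.one, lp.single_apply]

theorem shift_eval (f : H2) (z : 𝔻) : (shift f).eval z = z * f.eval z :=
  toeplitz_eval _ _ _

theorem shift_coeff (f : H2) : ⇑(shift f) = fun n => n.casesOn 0 fun k => f k := by
  refine coeff_unique (g := (shift f).eval) (H2.hasSum_eval _) fun z => ?_
  rw [shift_eval, ← hasSum_nat_add_iff' 1]
  have h := (H2.hasSum_eval f z).mul_left (z : ℂ)
  rw [Finset.sum_range_one]
  change HasSum (fun n => f n * (z : ℂ) ^ (n + 1)) (z * f.eval z - 0 * (z : ℂ) ^ 0)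
  rw [zero_mul, sub_zero]
  simpa only [pow_succ', mul_left_comm] using h

theorem shift_coeff_zero (f : H2) : shift f 0 = 0 :=
  congrFun (shift_coeff f) 0

theorem shift_coeff_succ (f : H2) (n : ℕ) : shift f (n + 1) = f n :=
  congrFun (shift_coeff f) (n + 1)

theorem inner_shift_shift (f g : H2) : (inner ℂ (shift f) (shift g) : ℂ) = inner ℂ f g := by
  refine (lp.hasSum_inner (𝕜 := ℂ) (shift f) (shift g)).unique ?_
  rw [← hasSum_nat_add_iff' 1, Finset.sum_range_one, shift_coeff_zero, inner_zero_left, sub_zero]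
  simp only [shift_coeff_succ]
  exact lp.hasSum_inner f g

theorem inner_one_left (f : H2) : (inner ℂ H2.one f : ℂ) = f 0 := by
  simp [H2.one, lp.inner_single_left]

theorem adjoint_shift_shift (f : H2) : ContinuousLinearMap.adjoint shift (shift f) = f :=
  ext_inner_left ℂ fun g => by rw [ContinuousLinearMap.adjoint_inner_right, inner_shift_shift]

theorem adjoint_shift_one : ContinuousLinearMap.adjoint shift H2.one = 0 :=
  ext_inner_right ℂ fun g => by
    rw [ContinuousLinearMap.adjoint_inner_left, inner_one_left, shift_coeff_zero, inner_zero_left]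

theorem exists_eq_shift_add (f : H2) :
    ∃ g : H2, (∀ n, g n = f (n + 1)) ∧ f = shift g + f 0 • H2.one := by
  have hm : Memℓp (fun n => f (n + 1)) 2 := by
    have h := lp.memℓp f
    rw [memℓp_gen_iff (by norm_num)] at h ⊢
    exact (summable_nat_add_iff 1).2 h
  refine ⟨⟨fun n => f (n + 1), hm⟩, fun n => rfl, lp.ext (funext fun n => ?_)⟩
  rw [H2.add_coeff, H2.smul_coeff]
  cases n with
  | zero => rw [shift_coeff_zero, H2.one_coeff_zero, zero_add, mul_one]
  | succ n => rw [shift_coeff_succ, H2.one_coeff_succ, mul_zero, add_zero]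

theorem shift_adjoint_shift (f : H2) :
    shift (ContinuousLinearMap.adjoint shift f) + (inner ℂ H2.one f : ℂ) • H2.one = f := by
  obtain ⟨g, -, h⟩ := exists_eq_shift_add f
  have h2 : ContinuousLinearMap.adjoint shift f = g := by
    rw [h, map_add, map_smul, adjoint_shift_shift, adjoint_shift_one, smul_zero, add_zero]
  rw [h2, inner_one_left]
  exact h.symm

theorem toeplitz_shift (b : HInf) (f : H2) : toeplitz b (shift f) = shift (toeplitz b f) := by
  apply H2.eval_injective
  funext z
  simp only [toeplitz_eval, shift_eval]
  ring

/-- The constant 1 is the reproducing kernel at the origin, hence an eigenvector of every adjoint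
Toeplitz operator. For the mate this gives κ. -/
theorem adjoint_toeplitz_one (b : HInf) : ContinuousLinearMap.adjoint (toeplitz b) H2.one
    = (starRingEnd ℂ ((b : 𝔻 → ℂ) 0)) • H2.one := by
  refine ext_inner_right ℂ fun f => ?_
  rw [ContinuousLinearMap.adjoint_inner_left, inner_one_left, inner_smul_left, inner_one_left,
    ← H2.eval_zero_point, toeplitz_eval, H2.eval_zero_point, Complex.conj_conj]

theorem norm_toeplitz_le {b : HInf} {M : ℝ} (hM : ∀ z, ‖(b : 𝔻 → ℂ) z‖ ≤ M) (f : H2) :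
    ‖toeplitz b f‖ ≤ M * ‖f‖ := by
  obtain ⟨g, hg, hgM⟩ := exists_mul b hM f
  rwa [H2.eval_injective (a₁ := toeplitz b f) (a₂ := g)
    (funext fun z => by rw [hg, toeplitz_eval])]

/-! ### Density of the range of an analytic Toeplitz operator -/

theorem H2.norm_one : ‖H2.one‖ = 1 := by
  simp [H2.one]

/-- The shifts of the constant function `1` span a dense subspace. -/
theorem eq_zero_of_inner_shift_pow (f : H2)
    (h : ∀ n : ℕ, (inner ℂ ((shift ^ n) H2.one) f : ℂ) = 0) : f = 0 := by
  have h1 : ∀ (n : ℕ) (g : H2), (inner ℂ ((shift ^ n) H2.one) g : ℂ) = g n := by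
    intro n
    induction n with
    | zero => exact inner_one_left
    | succ n ih =>
      intro g
      obtain ⟨k, hk, hg⟩ := exists_eq_shift_add g
      rw [pow_succ', mul_apply_eq_comp, ← hk, ← ih]
      conv_lhs => rw [hg]
      rw [inner_add_right, inner_shift_shift, inner_smul_right,
        ← inner_conj_symm (shift _) H2.one, inner_one_left, shift_coeff_zero, map_zero, mul_zero,
        add_zero]
  refine lp.ext (funext fun n => ?_)
  rw [← h1 n f, h]
  rfl

/-- If `f` is bounded by `1` and `f(0)` is close to `1` then `f` is close to `1` in `H²`. -/
theorem norm_toH2_sub_one_sq_le {f : HInf} (hf : f ∈ HInf.unitBall) :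
    ‖HInf.toH2 f - H2.one‖ ^ 2 ≤ 2 * ‖(f : 𝔻 → ℂ) 0 - 1‖ := by
  have h1 : ‖HInf.toH2 f‖ ≤ 1 := by
    have := norm_toeplitz_le hf H2.one
    rwa [H2.norm_one, mul_one] at this
  have h2 : (inner ℂ H2.one (HInf.toH2 f) : ℂ) = (f : 𝔻 → ℂ) 0 := by
    rw [inner_one_left, ← H2.eval_zero_point, HInf.toH2_eval]
  -- ‖f - 1‖² = ‖f‖² - 2 Re f(0) + 1 ≤ 2(1 - Re f(0)).
  rw [norm_sub_sq (𝕜 := ℂ), ← inner_re_symm, h2, H2.norm_one]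
  have h3 : 1 - ((f : 𝔻 → ℂ) 0).re ≤ ‖(f : 𝔻 → ℂ) 0 - 1‖ := by
    have := Complex.abs_re_le_norm ((f : 𝔻 → ℂ) 0 - 1)
    rw [Complex.sub_re, Complex.one_re] at this
    linarith [neg_abs_le (((f : 𝔻 → ℂ) 0).re - 1)]
  have h4 : ‖HInf.toH2 f‖ ^ 2 ≤ 1 := pow_le_one₀ (norm_nonneg _) h1
  simp only [RCLike.re_to_complex]
  linarith

/-- `T_a` has dense range if `a g_n` is bounded by `1` and converges to `1` at the origin. -/
theorem adjoint_toeplitz_injective {a : HInf} (g : ℕ → HInf)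
    (h1 : ∀ n z, ‖(a : 𝔻 → ℂ) z * (g n : 𝔻 → ℂ) z‖ ≤ 1)
    (h2 : Tendsto (fun n => (a : 𝔻 → ℂ) 0 * (g n : 𝔻 → ℂ) 0) atTop (𝓝 1))
    (hmul : ∀ n, ∃ p : HInf, ∀ z, (p : 𝔻 → ℂ) z = (a : 𝔻 → ℂ) z * (g n : 𝔻 → ℂ) z) :
    Function.Injective (ContinuousLinearMap.adjoint (toeplitz a)) := by
  rw [injective_iff_map_eq_zero]
  intro f hf
  choose p hp using hmul
  have hp1 : ∀ n, HInf.toH2 (p n) = toeplitz a (HInf.toH2 (g n)) := fun n => by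
    apply H2.eval_injective
    funext z
    rw [toeplitz_eval, HInf.toH2_eval, HInf.toH2_eval, hp]
  have hlim : Tendsto (fun n => HInf.toH2 (p n)) atTop (𝓝 H2.one) := by
    rw [tendsto_iff_norm_sub_tendsto_zero]
    have h3 : Tendsto (fun n => ‖HInf.toH2 (p n) - H2.one‖ ^ 2) atTop (𝓝 0) := by
      refine squeeze_zero (fun n => by positivity)
        (fun n => norm_toH2_sub_one_sq_le fun z => (hp n z).symm ▸ h1 n z) ?_
      simp only [hp]
      have := (tendsto_iff_norm_sub_tendsto_zero.1 h2).const_mul 2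
      rwa [mul_zero] at this
    have := h3.sqrt
    simpa [Real.sqrt_sq] using this
  -- A vector killed by T_a* is orthogonal to every zᵏ a g_n, hence to the limit zᵏ.
  refine eq_zero_of_inner_shift_pow f fun k => ?_
  have h4 : Tendsto (fun n => (inner ℂ ((shift ^ k) (HInf.toH2 (p n))) f : ℂ)) atTop
      (𝓝 (inner ℂ ((shift ^ k) H2.one) f)) :=
    (((shift ^ k).continuous.tendsto _).comp hlim).inner tendsto_const_nhds
  refine tendsto_nhds_unique h4 ?_
  have h5 : ∀ (k : ℕ) (x : H2), (shift ^ k) (toeplitz a x) = toeplitz a ((shift ^ k) x) := by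
    intro k
    induction k with
    | zero => exact fun x => rfl
    | succ k ih =>
      intro x
      rw [pow_succ, mul_apply_eq_comp, mul_apply_eq_comp,
        ← toeplitz_shift, ih]
  simp only [hp1, h5, ← ContinuousLinearMap.adjoint_inner_right (toeplitz a), hf, inner_zero_right]
  exact tendsto_const_nhds

/-! ### Outer functions -/

/-- The outer function with boundary modulus `exp g`. -/
def outerFn (g : ℂ → ℝ) (z : ℂ) : ℂ :=
  exp (Real.circleAverage (fun ζ => herglotzRieszKernel 0 z ζ • (g ζ : ℂ)) 0 1)

/-- The Poisson integral of `g`. -/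
def poissonInt (g : ℂ → ℝ) (z : ℂ) : ℝ :=
  Real.circleAverage ((Complex.re ∘ herglotzRieszKernel 0 z) • g) 0 1

theorem circleIntegrable_ofReal {g : ℂ → ℝ} (hg : CircleIntegrable g 0 1) :
    CircleIntegrable (fun ζ => (g ζ : ℂ)) 0 1 := by
  simp only [CircleIntegrable, intervalIntegrable_iff] at hg ⊢
  exact Complex.ofRealCLM.integrable_comp hg

theorem circleIntegrable_herglotz {g : ℂ → ℝ} (hg : CircleIntegrable g 0 1) {z : ℂ}
    (hz : z ∈ Metric.ball (0 : ℂ) 1) :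
    CircleIntegrable (fun ζ => herglotzRieszKernel 0 z ζ • (g ζ : ℂ)) 0 1 :=
  (circleIntegrable_ofReal hg).continuousOn_smul (continuousOn_herglotzRieszKernel_sphere hz)

theorem continuousOn_poisson {z : ℂ} (hz : z ∈ Metric.ball (0 : ℂ) 1) :
    ContinuousOn (Complex.re ∘ herglotzRieszKernel 0 z) (Metric.sphere 0 |1|) :=
  Complex.continuous_re.comp_continuousOn (continuousOn_herglotzRieszKernel_sphere hz)

theorem circleIntegrable_poisson {g : ℂ → ℝ} (hg : CircleIntegrable g 0 1) {z : ℂ}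
    (hz : z ∈ Metric.ball (0 : ℂ) 1) :
    CircleIntegrable ((Complex.re ∘ herglotzRieszKernel 0 z) • g) 0 1 :=
  hg.continuousOn_smul (continuousOn_poisson hz)

theorem differentiableOn_outerFn {g : ℂ → ℝ} (hg : CircleIntegrable g 0 1) :
    DifferentiableOn ℂ (outerFn g) (Metric.ball 0 1) :=
  (differentiableOn_circleAverage_herglotzRieszKernel_smul (circleIntegrable_ofReal hg)).cexp

theorem norm_outerFn {g : ℂ → ℝ} (hg : CircleIntegrable g 0 1) {z : ℂ}
    (hz : z ∈ Metric.ball (0 : ℂ) 1) : ‖outerFn g z‖ = Real.exp (poissonInt g z) := by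
  rw [outerFn, Complex.norm_exp, re_circleAverage_herglotzRieszKernel_smul hg hz, poissonInt]

theorem outerFn_add {g h : ℂ → ℝ} (hg : CircleIntegrable g 0 1) (hh : CircleIntegrable h 0 1)
    {z : ℂ} (hz : z ∈ Metric.ball (0 : ℂ) 1) :
    outerFn (g + h) z = outerFn g z * outerFn h z := by
  rw [outerFn, outerFn, outerFn, ← Complex.exp_add, ← Real.circleAverage_add
    (circleIntegrable_herglotz hg hz) (circleIntegrable_herglotz hh hz)]
  congr 2
  ext ζ
  simp [mul_add]

theorem poisson_nonneg {z ζ : ℂ} (hz : z ∈ Metric.ball (0 : ℂ) 1)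
    (hζ : ζ ∈ Metric.sphere (0 : ℂ) 1) : 0 ≤ (herglotzRieszKernel 0 z ζ).re := by
  refine le_trans ?_ (le_re_herglotzRieszKernel hζ hz)
  have : ‖z - 0‖ < 1 := by simpa using hz
  exact div_nonneg (by linarith) (by positivity)

theorem poissonInt_mono {g h : ℂ → ℝ} (hg : CircleIntegrable g 0 1)
    (hh : CircleIntegrable h 0 1) (hgh : ∀ ζ ∈ Metric.sphere (0 : ℂ) 1, g ζ ≤ h ζ)
    {z : ℂ} (hz : z ∈ Metric.ball (0 : ℂ) 1) : poissonInt g z ≤ poissonInt h z := by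
  refine Real.circleAverage_mono (circleIntegrable_poisson hg hz) (circleIntegrable_poisson hh hz)
    fun ζ hζ => ?_
  rw [abs_one] at hζ
  exact mul_le_mul_of_nonneg_left (hgh ζ hζ) (poisson_nonneg hz hζ)

theorem poissonInt_eq {F : ℂ → ℂ} (hF : DiffContOnCl ℂ F (Metric.ball 0 1)) {z : ℂ}
    (hz : z ∈ Metric.ball (0 : ℂ) 1) :
    Real.circleAverage ((Complex.re ∘ herglotzRieszKernel 0 z) • F) 0 1 = F z :=
  hF.circleAverage_re_herglotzRieszKernel_smul hz

theorem poissonInt_const (c : ℝ) {z : ℂ} (hz : z ∈ Metric.ball (0 : ℂ) 1) :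
    poissonInt (fun _ => c) z = c :=
  (InnerProductSpace.harmonicOnNhd_const c).circleAverage_re_herglotzRieszKernel_smul hz

theorem circleIntegrable_const_real (c : ℝ) : CircleIntegrable (fun _ => c) 0 1 :=
  continuousOn_const.circleIntegrable'

theorem poissonInt_le {g : ℂ → ℝ} (hg : CircleIntegrable g 0 1) {c : ℝ}
    (hgc : ∀ ζ ∈ Metric.sphere (0 : ℂ) 1, g ζ ≤ c)
    {z : ℂ} (hz : z ∈ Metric.ball (0 : ℂ) 1) : poissonInt g z ≤ c :=
  (poissonInt_mono hg (circleIntegrable_const_real c) hgc hz).trans_eq (poissonInt_const c hz)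

theorem poissonInt_nonpos {g : ℂ → ℝ} (hgc : ∀ ζ ∈ Metric.sphere (0 : ℂ) 1, g ζ ≤ 0)
    {z : ℂ} (hz : z ∈ Metric.ball (0 : ℂ) 1) : poissonInt g z ≤ 0 := by
  by_cases hg : CircleIntegrable ((Complex.re ∘ herglotzRieszKernel 0 z) • g) 0 1
  · rw [← Real.circleAverage_const (0 : ℝ) 0 1]
    refine Real.circleAverage_mono hg (circleIntegrable_const_real 0) fun ζ hζ => ?_
    rw [abs_one] at hζ
    exact mul_nonpos_of_nonneg_of_nonpos (poisson_nonneg hz hζ) (hgc ζ hζ)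
  -- Without integrability the average takes its default value 0.
  · exact (Real.circleAverage.integral_undef hg).le

/-- Dominated convergence for Poisson integrals. -/
theorem tendsto_poissonInt {ι : Type} {l : Filter ι} [l.IsCountablyGenerated] {g : ι → ℂ → ℝ}
    {h k : ℂ → ℝ} (hk : CircleIntegrable k 0 1) (hg : ∀ᶠ i in l, CircleIntegrable (g i) 0 1)
    (hgk : ∀ᶠ i in l, ∀ ζ ∈ Metric.sphere (0 : ℂ) 1, |g i ζ| ≤ |k ζ|)
    (hlim : ∀ᵐ t : ℝ, Tendsto (fun i => g i (circleMap 0 1 t)) l (𝓝 (h (circleMap 0 1 t))))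
    {z : ℂ} (hz : z ∈ Metric.ball (0 : ℂ) 1) :
    Tendsto (fun i => poissonInt (g i) z) l (𝓝 (poissonInt h z)) := by
  simp only [poissonInt, Real.circleAverage_def]
  refine Tendsto.const_smul ?_ _
  have hmem : ∀ t : ℝ, circleMap 0 1 t ∈ Metric.sphere (0 : ℂ) 1 := fun t =>
    circleMap_mem_sphere 0 zero_le_one t
  refine intervalIntegral.tendsto_integral_filter_of_dominated_convergence
    (fun t => |((Complex.re ∘ herglotzRieszKernel 0 z) • k) (circleMap 0 1 t)|) ?_ ?_ ?_ ?_
  · filter_upwards [hg] with i hi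
    exact (intervalIntegrable_iff.1 (circleIntegrable_poisson hi hz)).aestronglyMeasurable
  · filter_upwards [hgk] with i hi
    refine Eventually.of_forall fun t _ => ?_
    rw [Pi.smul_apply', Pi.smul_apply', smul_eq_mul, smul_eq_mul, norm_mul, abs_mul,
      Real.norm_eq_abs, Real.norm_eq_abs]
    exact mul_le_mul_of_nonneg_left (hi _ (hmem t)) (abs_nonneg _)
  · exact IntervalIntegrable.abs (circleIntegrable_poisson hk hz)
  · filter_upwards [hlim] with t ht _
    exact ht.const_mul _

/-- A bounded holomorphic function whose radial limits are at most `1` in modulus is bounded by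
`1`. -/
theorem norm_le_one_of_radial {F : ℂ → ℂ} (hF : DifferentiableOn ℂ F (Metric.ball 0 1)) {C : ℝ}
    (hC : ∀ z ∈ Metric.ball (0 : ℂ) 1, ‖F z‖ ≤ C)
    (hlim : ∀ᵐ t : ℝ, Tendsto (fun r : ℝ => max ‖F (r * circleMap 0 1 t)‖ 1) (𝓝[<] 1) (𝓝 1))
    {z : ℂ} (hz : z ∈ Metric.ball (0 : ℂ) 1) : ‖F z‖ ≤ 1 := by
  have hr : ∀ᶠ r : ℝ in 𝓝[<] 1, r ∈ Set.Ioo (0 : ℝ) 1 :=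
    Ioo_mem_nhdsLT (by norm_num)
  have hball : ∀ r ∈ Set.Ioo (0 : ℝ) 1, ∀ ζ ∈ Metric.closedBall (0 : ℂ) 1,
      (r : ℂ) * ζ ∈ Metric.ball (0 : ℂ) 1 := fun r hr ζ hζ => by
    rw [mem_closedBall_zero_iff] at hζ
    rw [mem_ball_zero_iff, norm_mul, Complex.norm_real, Real.norm_eq_abs, abs_of_pos hr.1]
    nlinarith [hr.1, hr.2, norm_nonneg ζ]
  have hdiff : ∀ r ∈ Set.Ioo (0 : ℝ) 1,
      DifferentiableOn ℂ (fun ζ => F (r * ζ)) (Metric.closedBall 0 1) := fun r hr =>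
    hF.comp (differentiableOn_id.const_mul _) fun ζ hζ => hball r hr ζ hζ
  have hint : ∀ r ∈ Set.Ioo (0 : ℝ) 1,
      CircleIntegrable (fun ζ => max ‖F (r * ζ)‖ 1) 0 1 := fun r hr => by
    refine ContinuousOn.circleIntegrable' ?_
    rw [abs_one]
    exact ((hdiff r hr).continuousOn.mono Metric.sphere_subset_closedBall).norm.sup
      continuousOn_const
  -- F(r·) is the Poisson integral of its values on the circle, so ‖F(rz)‖ is at most the Poisson
  -- integral of max(‖F(rζ)‖, 1), which tends to 1. The maximum turns a bound on the radial limits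
  -- into a convergence statement.
  have h1 : Tendsto (fun r : ℝ => poissonInt (fun ζ => max ‖F (r * ζ)‖ 1) z) (𝓝[<] 1)
      (𝓝 (poissonInt (fun _ => 1) z)) := by
    refine tendsto_poissonInt (circleIntegrable_const_real (max C 1)) (hr.mono hint) ?_ hlim hz
    filter_upwards [hr] with r hr ζ hζ
    rw [abs_of_pos (by positivity), abs_of_pos (by positivity)]
    exact max_le_max (hC _ (hball r hr ζ (Metric.sphere_subset_closedBall hζ))) le_rfl
  rw [poissonInt_const 1 hz] at h1
  have h2 : Tendsto (fun r : ℝ => ‖F (r * z)‖) (𝓝[<] 1) (𝓝 ‖F z‖) := by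
    have hc : ContinuousAt F (((1 : ℝ) : ℂ) * z) := by
      rw [Complex.ofReal_one, one_mul]
      exact (hF.differentiableAt (Metric.isOpen_ball.mem_nhds hz)).continuousAt
    have h3 : ContinuousAt (fun r : ℝ => F (r * z)) 1 :=
      ContinuousAt.comp (f := fun r : ℝ => (r : ℂ) * z) hc (by fun_prop)
    have h4 := h3.norm.tendsto.mono_left (nhdsWithin_le_nhds (s := Set.Iio 1))
    simpa using h4
  refine le_of_tendsto_of_tendsto h2 h1 ?_
  filter_upwards [hr] with r hr
  have hd : DiffContOnCl ℂ (fun ζ => F (r * ζ)) (Metric.ball 0 1) := by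
    refine DifferentiableOn.diffContOnCl ?_
    rw [closure_ball _ one_ne_zero]
    exact hdiff r hr
  rw [← poissonInt_eq hd hz, poissonInt, Real.circleAverage_def, Real.circleAverage_def, norm_smul,
    smul_eq_mul, Real.norm_of_nonneg (by positivity)]
  refine mul_le_mul_of_nonneg_left ?_ (by positivity)
  refine intervalIntegral.norm_integral_le_of_norm_le Real.two_pi_pos.le
    (Eventually.of_forall fun t _ => ?_) (circleIntegrable_poisson (hint r hr) hz)
  have hp := poisson_nonneg hz (circleMap_mem_sphere 0 zero_le_one t)
  rw [Pi.smul_apply', Pi.smul_apply', norm_smul, Function.comp_apply, Real.norm_of_nonneg hp,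
    smul_eq_mul]
  exact mul_le_mul_of_nonneg_left (le_max_left _ _) hp

theorem circleIntegrable_min {g h : ℂ → ℝ} (hg : CircleIntegrable g 0 1)
    (hh : CircleIntegrable h 0 1) : CircleIntegrable (fun ζ => min (g ζ) (h ζ)) 0 1 := by
  simp only [CircleIntegrable, intervalIntegrable_iff] at hg hh ⊢
  exact hg.inf hh

/-- An outer function whose radial limits are at most `1` in modulus is bounded by `1`. -/
theorem norm_outerFn_le_one {g : ℂ → ℝ} (hg : CircleIntegrable g 0 1)
    (hlim : ∀ᵐ t : ℝ, Tendsto (fun r : ℝ => max ‖outerFn g (r * circleMap 0 1 t)‖ 1)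
      (𝓝[<] 1) (𝓝 1))
    {z : ℂ} (hz : z ∈ Metric.ball (0 : ℂ) 1) : ‖outerFn g z‖ ≤ 1 := by
  have hmin : ∀ M : ℕ, CircleIntegrable (fun ζ => min (g ζ) M) 0 1 := fun M =>
    circleIntegrable_min hg (circleIntegrable_const_real M)
  -- An unbounded function such as exp((1 + z)/(1 - z)) can have unimodular radial limits, so
  -- outerness must be used. Cutting g off at M gives an outer function bounded by exp M and
  -- dominated in modulus by `outerFn g`; the bounded case applies to it, and then M → ∞.
  have h1 : ∀ M : ℕ, poissonInt (fun ζ => min (g ζ) M) z ≤ 0 := by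
    intro M
    rw [← Real.exp_le_one_iff, ← norm_outerFn (hmin M) hz]
    refine norm_le_one_of_radial (C := Real.exp M) (differentiableOn_outerFn (hmin M))
      (fun w hw => ?_) ?_ hz
    · rw [norm_outerFn (hmin M) hw, Real.exp_le_exp]
      exact poissonInt_le (hmin M) (fun ζ _ => min_le_right _ _) hw
    · filter_upwards [hlim] with t ht
      refine tendsto_of_tendsto_of_tendsto_of_le_of_le' tendsto_const_nhds ht
        (Eventually.of_forall fun r => le_max_right _ _) ?_
      filter_upwards [Ioo_mem_nhdsLT (show (0 : ℝ) < 1 by norm_num)] with r hr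
      have hw : (r : ℂ) * circleMap 0 1 t ∈ Metric.ball (0 : ℂ) 1 := by
        simpa [abs_of_pos hr.1] using hr.2
      refine max_le_max ?_ le_rfl
      rw [norm_outerFn (hmin M) hw, norm_outerFn hg hw, Real.exp_le_exp]
      exact poissonInt_mono (hmin M) hg (fun ζ _ => min_le_left _ _) hw
  have h2 : Tendsto (fun M : ℕ => poissonInt (fun ζ => min (g ζ) M) z) atTop
      (𝓝 (poissonInt g z)) := by
    refine tendsto_poissonInt hg (Eventually.of_forall hmin) (Eventually.of_forall ?_)
      (Eventually.of_forall fun t => ?_) hz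
    · intro M ζ _
      rcases le_total (g ζ) M with h | h
      · rw [min_eq_left h]
      · rw [min_eq_right h, abs_of_nonneg (Nat.cast_nonneg M)]
        exact h.trans (le_abs_self _)
    · refine tendsto_const_nhds.congr' ?_
      filter_upwards [eventually_ge_atTop ⌈g (circleMap 0 1 t)⌉₊] with M hM
      rw [min_eq_left (Nat.ceil_le.1 hM)]
  rw [norm_outerFn hg hz, Real.exp_le_one_iff]
  exact le_of_tendsto h2 (Eventually.of_forall h1)

theorem outerFn_zero (g : ℂ → ℝ) : outerFn g 0 = exp ((Real.circleAverage g 0 1 : ℝ) : ℂ) := by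
  rw [outerFn, Real.circleAverage_congr_sphere (f₂ := fun ζ => (g ζ : ℂ))]
  · simp only [Real.circleAverage_def]
    rw [intervalIntegral.integral_ofReal]
    simp
  · intro ζ hζ
    have : ζ ≠ 0 := by
      rintro rfl
      simp at hζ
    simp [herglotzRieszKernel_def, div_self this]

theorem poissonInt_zero (g : ℂ → ℝ) : poissonInt g 0 = Real.circleAverage g 0 1 := by
  refine Real.circleAverage_congr_sphere fun ζ hζ => ?_
  have : ζ ≠ 0 := by
    rintro rfl
    simp at hζ
  simp [herglotzRieszKernel_def, div_self this]

/-- Bounded outer functions `h n` such that `outerFn g * h n` is bounded by `1` and tends to `1` at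
the origin. -/
theorem exists_outerFn_inverse {g : ℂ → ℝ} (hg : CircleIntegrable g 0 1) :
    ∃ h : ℕ → ℂ → ℂ, (∀ n, DifferentiableOn ℂ (h n) (Metric.ball 0 1)) ∧
      (∀ n, ∃ M : ℝ, ∀ z ∈ Metric.ball (0 : ℂ) 1, ‖h n z‖ ≤ M) ∧
      (∀ n, ∀ z ∈ Metric.ball (0 : ℂ) 1, ‖outerFn g z * h n z‖ ≤ 1) ∧
      Tendsto (fun n => outerFn g 0 * h n 0) atTop (𝓝 1) := by
  have hk : ∀ n : ℕ, CircleIntegrable (fun ζ => min (-g ζ) n) 0 1 := fun n =>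
    circleIntegrable_min (IntervalIntegrable.neg hg) (circleIntegrable_const_real n)
  have h0 : (0 : ℂ) ∈ Metric.ball (0 : ℂ) 1 := by simp
  -- The factor has boundary modulus exp(min(-g, n)), a truncation of 1/|outerFn g|. The product has
  -- logarithmic modulus min(0, g + n), which is nonpositive, bounded by |g| and tends to 0
  -- pointwise.
  refine ⟨fun n => outerFn fun ζ => min (-g ζ) n, fun n => differentiableOn_outerFn (hk n),
    fun n => ⟨Real.exp n, fun z hz => ?_⟩, fun n z hz => ?_, ?_⟩
  · rw [norm_outerFn (hk n) hz, Real.exp_le_exp]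
    exact poissonInt_le (hk n) (fun ζ _ => min_le_right _ _) hz
  · rw [← outerFn_add hg (hk n) hz, norm_outerFn (hg.add (hk n)) hz,
      Real.exp_le_one_iff]
    refine poissonInt_nonpos (fun ζ _ => ?_) hz
    have := min_le_left (-g ζ) (n : ℝ)
    rw [Pi.add_apply]
    linarith
  · have h1 : ∀ n : ℕ, outerFn g 0 * outerFn (fun ζ => min (-g ζ) n) 0
        = exp (poissonInt (g + fun ζ => min (-g ζ) n) 0 : ℝ) := fun n => by
      rw [← outerFn_add hg (hk n) h0, outerFn_zero, poissonInt_zero]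
    simp only [h1]
    have h2 : Tendsto (fun n : ℕ => poissonInt (g + fun ζ => min (-g ζ) n) 0) atTop
        (𝓝 (poissonInt (fun _ => 0) 0)) := by
      refine tendsto_poissonInt hg (Eventually.of_forall fun n => hg.add (hk n))
        (Eventually.of_forall ?_) (Eventually.of_forall fun t => ?_) h0
      · intro n ζ _
        rw [Pi.add_apply]
        rcases le_total (-g ζ) n with h | h
        · rw [min_eq_left h, add_neg_cancel, abs_zero]
          exact abs_nonneg _
        · rw [min_eq_right h, abs_le]
          have h5 : (0 : ℝ) ≤ n := Nat.cast_nonneg n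
          constructor <;> linarith [neg_abs_le (g ζ), abs_nonneg (g ζ)]
      · refine tendsto_const_nhds.congr' ?_
        filter_upwards [eventually_ge_atTop ⌈-g (circleMap 0 1 t)⌉₊] with n hn
        rw [Pi.add_apply, min_eq_left (Nat.ceil_le.1 hn), add_neg_cancel]
    rw [poissonInt_const 0 h0] at h2
    have h3 := (Complex.continuous_exp.comp Complex.continuous_ofReal).continuousAt.tendsto.comp h2
    simpa [Function.comp_def] using h3

/-- Outer functions are unimodular multiples of functions `outerFn g`. -/
theorem IsOuter.exists_eq_outerFn {a : 𝔻 → ℂ} (ha : IsOuter a) :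
    ∃ (c : ℂ) (g : ℂ → ℝ), ‖c‖ = 1 ∧ CircleIntegrable g 0 1 ∧ ∀ z : 𝔻, a z = c * outerFn g z := by
  obtain ⟨c, φ, hc, -, hφ, ha⟩ := ha
  -- Arguments are normalised to (0, 2π], exactly the half-open interval over which the integral
  -- from 0 to 2π is taken; φ need not be periodic.
  let g : ℂ → ℝ := fun ζ => Real.log (φ (toIocMod Real.two_pi_pos 0 ζ.arg))
  have hg : ∀ t ∈ Set.uIoc 0 (2 * Real.pi), g (circleMap 0 1 t) = Real.log (φ t) := by
    intro t ht
    rw [Set.uIoc_of_le Real.two_pi_pos.le] at ht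
    simp only [g]
    rw [circleMap_zero, Complex.ofReal_one, one_mul, Complex.arg_exp_mul_I, toIocMod_toIocMod,
      (toIocMod_eq_self Real.two_pi_pos).2]
    rwa [zero_add]
  refine ⟨c, g, hc, ?_, fun z => ?_⟩
  · exact hφ.congr fun t ht => (hg t ht).symm
  · rw [ha, outerFn, Real.circleAverage_def]
    congr 2
    rw [Complex.real_smul]
    congr 1
    · push_cast
      rw [one_div]
    · refine intervalIntegral.integral_congr_ae (Eventually.of_forall fun t ht => ?_)
      rw [hg t ht, smul_eq_mul, herglotzRieszKernel_def, circleMap_zero]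
      simp

/-! ### Circle means and boundary values -/

theorem HasRadialLimit.tendsto {f : 𝔻 → ℂ} {F : ℂ → ℂ} (hF : ∀ z : 𝔻, f z = F z) {t : ℝ} {l : ℂ}
    (h : HasRadialLimit f t l) :
    Tendsto (fun r : ℝ => F (r * circleMap 0 1 t)) (𝓝[<] 1) (𝓝 l) := by
  refine Tendsto.congr' ?_ h
  filter_upwards [Ioo_mem_nhdsLT (show (0 : ℝ) < 1 by norm_num)] with r hr
  have h1 : ‖(r : ℂ) * exp (t * I)‖ < 1 := by
    rw [norm_mul, Complex.norm_exp_ofReal_mul_I, mul_one, Complex.norm_real, Real.norm_eq_abs,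
      abs_of_pos hr.1]
    exact hr.2
  rw [dif_pos h1, hF]
  simp [circleMap_zero]

theorem mul_sphere_mem_ball {r : ℝ} (hr : r ∈ Set.Ioo (0 : ℝ) 1) {ζ : ℂ}
    (hζ : ζ ∈ Metric.sphere (0 : ℂ) 1) : (r : ℂ) * ζ ∈ Metric.ball (0 : ℂ) 1 := by
  rw [mem_sphere_zero_iff_norm] at hζ
  rw [mem_ball_zero_iff, norm_mul, hζ, mul_one, Complex.norm_real, Real.norm_eq_abs,
    abs_of_pos hr.1]
  exact hr.2

/-- Parseval's identity on the circle of radius `r < 1`. -/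
theorem hasSum_circleAverage {f : H2} {G : ℂ → ℂ} (hG : ∀ z : 𝔻, f.eval z = G z) {r : ℝ}
    (hr : r ∈ Set.Ioo (0 : ℝ) 1) :
    HasSum (fun n => (‖f n‖ * r ^ n) ^ 2)
      (Real.circleAverage (fun ζ => ‖G (r * ζ)‖ ^ 2) 0 1) := by
  have hc : Summable fun n => ‖f n * (r : ℂ) ^ n‖ := by
    simpa [abs_of_pos hr.1] using H2.summable_norm f hr.1.le hr.2
  obtain ⟨u, hu, hu2⟩ := parseval hc
  have hux : ∀ x : AddCircle (1 : ℝ), u x = G (r * AddCircle.toCircle x) := by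
    intro x
    have hz : ‖(r : ℂ) * AddCircle.toCircle x‖ < 1 := by
      rw [← mem_ball_zero_iff]
      exact mul_sphere_mem_ball hr (mem_sphere_zero_iff_norm.2 (Circle.norm_coe _))
    have h1 := H2.hasSum_eval f (UnitDisc.mk _ hz)
    rw [hG, UnitDisc.coe_mk] at h1
    refine (hu x).unique ?_
    convert h1 using 2 with n
    rw [fourier_apply, mul_pow, ← Circle.coe_pow, ← AddCircle.toCircle_nsmul, mul_assoc]
    simp
  have hnorm : ‖ContinuousMap.toLp (E := ℂ) 2 AddCircle.haarAddCircle ℂ u‖ ^ 2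
      = ∫ x : AddCircle (1 : ℝ), ‖u x‖ ^ 2 := by
    have h1 : (volume : Measure (AddCircle (1 : ℝ))) = AddCircle.haarAddCircle := by
      rw [AddCircle.volume_eq_smul_haarAddCircle, ENNReal.ofReal_one, one_smul]
    rw [h1, ← inner_self_eq_norm_sq (𝕜 := ℂ), L2.inner_def, ← integral_re]
    · refine integral_congr_ae ?_
      filter_upwards [ContinuousMap.coeFn_toLp (E := ℂ) (p := 2) (𝕜 := ℂ)
        AddCircle.haarAddCircle u] with x hx
      rw [hx, inner_self_eq_norm_sq]
    · exact L2.integrable_inner _ _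
  have hint : ∫ x : AddCircle (1 : ℝ), ‖u x‖ ^ 2
      = Real.circleAverage (fun ζ => ‖G (r * ζ)‖ ^ 2) 0 1 := by
    have h1 : ∀ x : ℝ, ‖u x‖ ^ 2 = ‖G (r * circleMap 0 1 (2 * Real.pi * x))‖ ^ 2 := by
      intro x
      rw [hux, AddCircle.toCircle_apply_mk, circleMap_zero, Circle.coe_exp]
      simp
    rw [← AddCircle.intervalIntegral_preimage (1 : ℝ) 0]
    simp only [h1]
    rw [intervalIntegral.integral_comp_mul_left
      (fun t => ‖G (r * circleMap 0 1 t)‖ ^ 2) Real.two_pi_pos.ne', Real.circleAverage_def]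
    simp
  rw [← hint, ← hnorm]
  refine hu2.congr_fun fun n => ?_
  simp [abs_of_pos hr.1]

/-- The mean over the circle of radius r is ∑ |fₙ|² r²ⁿ, dominated by ∑ |fₙ|²; no boundary values of
f are needed. -/
theorem tendsto_circleAverage {f : H2} {G : ℂ → ℂ} (hG : ∀ z : 𝔻, f.eval z = G z) :
    Tendsto (fun r : ℝ => Real.circleAverage (fun ζ => ‖G (r * ζ)‖ ^ 2) 0 1) (𝓝[<] 1)
      (𝓝 (‖f‖ ^ 2)) := by
  have hf : HasSum (fun n => ‖f n‖ ^ 2) (‖f‖ ^ 2) := by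
    simpa using lp.hasSum_norm (p := 2) (by norm_num) f
  have hr : ∀ᶠ r : ℝ in 𝓝[<] 1, r ∈ Set.Ioo (0 : ℝ) 1 := Ioo_mem_nhdsLT (by norm_num)
  have h1 : Tendsto (fun r : ℝ => ∑' n, (‖f n‖ * r ^ n) ^ 2) (𝓝[<] 1) (𝓝 (∑' n, ‖f n‖ ^ 2)) := by
    refine tendsto_tsum_of_dominated_convergence hf.summable (fun n => ?_) ?_
    · have : Continuous fun r : ℝ => (‖f n‖ * r ^ n) ^ 2 := by fun_prop
      simpa using (this.tendsto 1).mono_left nhdsWithin_le_nhds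
    · filter_upwards [hr] with r hr n
      have h0 := hr.1
      rw [Real.norm_of_nonneg (by positivity)]
      exact pow_le_pow_left₀ (by positivity)
        (mul_le_of_le_one_right (norm_nonneg _) (pow_le_one₀ hr.1.le hr.2.le)) 2
  rw [hf.tsum_eq] at h1
  refine h1.congr' ?_
  filter_upwards [hr] with r hr
  exact (hasSum_circleAverage hG hr).tsum_eq

/-- If `|a|² + |b|² = 1` almost everywhere on the circle then `‖a p‖² + ‖b p‖² = ‖p‖²` for all
polynomials `p`. -/
theorem norm_sq_add_norm_sq_of_polynomial {a b : HInf} (ha : a ∈ HInf.unitBall)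
    (hb : b ∈ HInf.unitBall)
    (hab : ∀ᵐ t : ℝ, ∃ α β : ℂ, HasRadialLimit a t α ∧ HasRadialLimit b t β ∧
      ‖α‖ ^ 2 + ‖β‖ ^ 2 = 1) {p : H2} {s : Finset ℕ} (hp : ∀ n ∉ s, p n = 0) :
    ‖toeplitz a p‖ ^ 2 + ‖toeplitz b p‖ ^ 2 = ‖p‖ ^ 2 := by
  obtain ⟨F, hF, haF⟩ := a.2.1
  obtain ⟨G, hG, hbG⟩ := b.2.1
  let P : ℂ → ℂ := fun z => ∑ n ∈ s, p n * z ^ n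
  have hPc : Continuous P := by fun_prop
  have hP : ∀ z : 𝔻, p.eval z = P z := fun z =>
    tsum_eq_sum fun n hn => by rw [hp n hn, zero_mul]
  have h1 := tendsto_circleAverage (f := toeplitz a p) (G := fun z => F z * P z) fun z => by
    rw [toeplitz_eval, haF, hP]
  have h2 := tendsto_circleAverage (f := toeplitz b p) (G := fun z => G z * P z) fun z => by
    rw [toeplitz_eval, hbG, hP]
  have h3 := tendsto_circleAverage hP
  have hr : ∀ᶠ r : ℝ in 𝓝[<] 1, r ∈ Set.Ioo (0 : ℝ) 1 := Ioo_mem_nhdsLT (by norm_num)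
  have hle : ∀ {E : ℂ → ℂ} {e : HInf}, e ∈ HInf.unitBall → (∀ z : 𝔻, (e : 𝔻 → ℂ) z = E z) →
      ∀ z ∈ Metric.ball (0 : ℂ) 1, ‖E z‖ ≤ 1 := fun he heE z hz => by
    have := he (UnitDisc.mk z (mem_ball_zero_iff.1 hz))
    rwa [heE] at this
  have hcont : ∀ {E : ℂ → ℂ}, ContinuousOn E (Metric.ball 0 1) → ∀ r ∈ Set.Ioo (0 : ℝ) 1,
      ContinuousOn (fun ζ => ‖E (r * ζ)‖ ^ 2) (Metric.sphere 0 |1|) := fun {E} hE r hr => by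
    refine ((hE.comp (f := fun ζ : ℂ => (r : ℂ) * ζ) (by fun_prop) ?_).norm).pow 2
    rw [abs_one]
    exact fun ζ hζ => mul_sphere_mem_ball hr hζ
  have hFP : ContinuousOn (fun z => F z * P z) (Metric.ball 0 1) :=
    hF.continuousOn.mul hPc.continuousOn
  have hGP : ContinuousOn (fun z => G z * P z) (Metric.ball 0 1) :=
    hG.continuousOn.mul hPc.continuousOn
  have hall : ∀ r ∈ Set.Ioo (0 : ℝ) 1, ContinuousOn (fun ζ => ‖F (r * ζ) * P (r * ζ)‖ ^ 2
      + ‖G (r * ζ) * P (r * ζ)‖ ^ 2 - ‖P (r * ζ)‖ ^ 2) (Metric.sphere 0 |1|) := fun r hr =>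
    ((hcont hFP r hr).add (hcont hGP r hr)).sub (hcont hPc.continuousOn r hr)
  -- The integrand is (|F|² + |G|² - 1)|P|². It tends to 0 almost everywhere, and it is bounded
  -- because P is a polynomial and the first factor lies in [-1, 1]. Its circle mean is its Poisson
  -- integral at the origin.
  have h4 : Tendsto (fun r : ℝ => Real.circleAverage (fun ζ => ‖F (r * ζ) * P (r * ζ)‖ ^ 2
      + ‖G (r * ζ) * P (r * ζ)‖ ^ 2 - ‖P (r * ζ)‖ ^ 2) 0 1) (𝓝[<] 1) (𝓝 0) := by
    have h5 : Tendsto (fun r : ℝ => poissonInt (fun ζ => ‖F (r * ζ) * P (r * ζ)‖ ^ 2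
      + ‖G (r * ζ) * P (r * ζ)‖ ^ 2 - ‖P (r * ζ)‖ ^ 2) 0) (𝓝[<] 1)
      (𝓝 (poissonInt (fun _ => 0) 0)) := by
      obtain ⟨C, hC⟩ := (isCompact_closedBall (0 : ℂ) 1).exists_bound_of_continuousOn
        hPc.continuousOn
      refine tendsto_poissonInt (circleIntegrable_const_real (C ^ 2))
        (hr.mono fun r hr => (hall r hr).circleIntegrable') ?_ ?_ (by simp)
      · filter_upwards [hr] with r hr ζ hζ
        have hm := mul_sphere_mem_ball hr hζ
        have e1 := hle ha haF _ hm
        have e2 := hle hb hbG _ hm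
        have e3 : ‖P (r * ζ)‖ ^ 2 ≤ C ^ 2 :=
          pow_le_pow_left₀ (norm_nonneg _) (hC _ (Metric.ball_subset_closedBall hm)) 2
        have e4 : ‖F (r * ζ)‖ ^ 2 ≤ 1 := pow_le_one₀ (norm_nonneg _) e1
        have e5 : ‖G (r * ζ)‖ ^ 2 ≤ 1 := pow_le_one₀ (norm_nonneg _) e2
        rw [norm_mul, norm_mul, mul_pow, mul_pow, abs_of_nonneg (sq_nonneg C),
          show ∀ x y z : ℝ, x * z + y * z - z = (x + y - 1) * z by intros; ring, abs_mul,
          abs_of_nonneg (sq_nonneg ‖P (r * ζ)‖)]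
        refine le_trans (mul_le_of_le_one_left (sq_nonneg _) ?_) e3
        rw [abs_le]
        constructor <;> nlinarith [sq_nonneg ‖F (r * ζ)‖, sq_nonneg ‖G (r * ζ)‖]
      · filter_upwards [hab] with t ht
        obtain ⟨α, β, hα, hβ, hαβ⟩ := ht
        have e1 := hα.tendsto haF
        have e2 := hβ.tendsto hbG
        have e3 : Tendsto (fun r : ℝ => P (r * circleMap 0 1 t)) (𝓝[<] 1)
            (𝓝 (P (((1 : ℝ) : ℂ) * circleMap 0 1 t))) := by
          have : Continuous fun r : ℝ => P (r * circleMap 0 1 t) := by fun_prop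
          exact (this.tendsto 1).mono_left nhdsWithin_le_nhds
        have e4 := (((e1.mul e3).norm.pow 2).add ((e2.mul e3).norm.pow 2)).sub (e3.norm.pow 2)
        convert e4 using 2
        rw [norm_mul, norm_mul, mul_pow, mul_pow, ← add_mul, hαβ, one_mul, sub_self]
    simpa only [poissonInt_zero, Real.circleAverage_const] using h5
  have h6 := (h1.add h2).sub h3
  have h7 := tendsto_nhds_unique (h6.congr' ?_) h4
  · linarith
  · filter_upwards [hr] with r hr
    have i1 := (hcont hFP r hr).circleIntegrable'
    have i2 := (hcont hGP r hr).circleIntegrable'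
    have i3 := (hcont hPc.continuousOn r hr).circleIntegrable'
    rw [← Real.circleAverage_add i1 i2, ← Real.circleAverage_sub (i1.add i2) i3]
    rfl

/-- Both sides are continuous in f, and Taylor polynomials converge to f in H². -/
theorem norm_sq_add_norm_sq_toeplitz {a b : HInf} (ha : a ∈ HInf.unitBall)
    (hb : b ∈ HInf.unitBall)
    (hab : ∀ᵐ t : ℝ, ∃ α β : ℂ, HasRadialLimit a t α ∧ HasRadialLimit b t β ∧
      ‖α‖ ^ 2 + ‖β‖ ^ 2 = 1) (f : H2) :
    ‖toeplitz a f‖ ^ 2 + ‖toeplitz b f‖ ^ 2 = ‖f‖ ^ 2 := by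
  have h1 : Tendsto (fun s : Finset ℕ => ∑ n ∈ s, lp.single 2 n (f n)) atTop (𝓝 f) :=
    lp.hasSum_single (by norm_num) f
  have h2 : ∀ s : Finset ℕ, ‖toeplitz a (∑ n ∈ s, lp.single 2 n (f n))‖ ^ 2
      + ‖toeplitz b (∑ n ∈ s, lp.single 2 n (f n))‖ ^ 2
      = ‖∑ n ∈ s, lp.single (E := fun _ : ℕ => ℂ) 2 n (f n)‖ ^ 2 := fun s => by
    refine norm_sq_add_norm_sq_of_polynomial ha hb hab (s := s) fun n hn => ?_
    rw [lp.coeFn_sum, Finset.sum_apply]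
    refine Finset.sum_eq_zero fun k hk => ?_
    rw [lp.single_apply_ne]
    rintro rfl
    exact hn hk
  have h3 := ((((toeplitz a).continuous.tendsto f).comp h1).norm.pow 2).add
    ((((toeplitz b).continuous.tendsto f).comp h1).norm.pow 2)
  exact tendsto_nhds_unique (h3.congr h2) (h1.norm.pow 2)

/-- Over ℂ an operator whose quadratic form vanishes is zero. -/
theorem adjoint_toeplitz_add {a b : HInf}
    (h : ∀ f, ‖toeplitz a f‖ ^ 2 + ‖toeplitz b f‖ ^ 2 = ‖f‖ ^ 2) (f : H2) :
    ContinuousLinearMap.adjoint (toeplitz a) (toeplitz a f)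
      + ContinuousLinearMap.adjoint (toeplitz b) (toeplitz b f) = f := by
  let D : H2 →L[ℂ] H2 := ContinuousLinearMap.adjoint (toeplitz a) ∘L toeplitz a
    + ContinuousLinearMap.adjoint (toeplitz b) ∘L toeplitz b - ContinuousLinearMap.id ℂ H2
  have hD : D.toLinearMap = 0 := by
    rw [← inner_map_self_eq_zero]
    intro x
    change (inner ℂ (ContinuousLinearMap.adjoint (toeplitz a) (toeplitz a x)
      + ContinuousLinearMap.adjoint (toeplitz b) (toeplitz b x) - x) x : ℂ) = 0
    rw [inner_sub_left, inner_add_left, ContinuousLinearMap.adjoint_inner_left,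
      ContinuousLinearMap.adjoint_inner_left, inner_self_eq_norm_sq_to_K,
      inner_self_eq_norm_sq_to_K, inner_self_eq_norm_sq_to_K, sub_eq_zero]
    exact_mod_cast h x
  exact sub_eq_zero.1 (LinearMap.congr_fun hD f)

/-! ### The pythagorean mate -/

/-- The pythagorean mate is bounded by `1`, and the adjoint of its Toeplitz operator is
injective. -/
theorem IsPythagoreanMate.exists_HInf {a b : 𝔻 → ℂ} (h : IsPythagoreanMate b a) :
    ∃ A : HInf, (A : 𝔻 → ℂ) = a ∧ A ∈ HInf.unitBall ∧
      Function.Injective (ContinuousLinearMap.adjoint (toeplitz A)) := by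
  obtain ⟨c, g, hc, hg, hag⟩ := h.outer.exists_eq_outerFn
  have hball : ∀ z : 𝔻, (z : ℂ) ∈ Metric.ball (0 : ℂ) 1 := fun z => by
    simpa using z.norm_lt_one
  have hc0 : c ≠ 0 := norm_ne_zero_iff.1 (by rw [hc]; exact one_ne_zero)
  have hle : ∀ z : 𝔻, ‖a z‖ ≤ 1 := by
    intro z
    rw [hag, norm_mul, hc, one_mul]
    refine norm_outerFn_le_one hg ?_ (hball z)
    filter_upwards [h.norm_sq_add_norm_sq] with t ht
    obtain ⟨α, β, hα, -, hαβ⟩ := ht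
    have h1 := (hα.tendsto (F := fun z => c * outerFn g z) hag).norm
    simp only [norm_mul, hc, one_mul] at h1
    have h2 : ‖α‖ ≤ 1 := by
      refine (sq_le_one_iff₀ (norm_nonneg _)).1 ?_
      linarith [sq_nonneg ‖β‖]
    have h3 := h1.max (tendsto_const_nhds (x := (1 : ℝ)))
    rwa [max_eq_right h2] at h3
  have hholo : IsHolo a := ⟨fun z => c * outerFn g z, (differentiableOn_outerFn hg).const_mul c,
    hag⟩
  let A : HInf := ⟨a, hholo, 1, hle⟩
  refine ⟨A, rfl, hle, ?_⟩
  obtain ⟨k, hkd, hkb, hk1, hk0⟩ := exists_outerFn_inverse hg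
  -- The factor c⁻¹ cancels the unimodular constant of the outer function a.
  let K : ℕ → HInf := fun n => ⟨fun z => c⁻¹ * k n z,
    ⟨fun z => c⁻¹ * k n z, (hkd n).const_mul _, fun z => rfl⟩, (hkb n).choose, fun z => by
      rw [norm_mul, norm_inv, hc, inv_one, one_mul]
      exact (hkb n).choose_spec z (hball z)⟩
  have hAK : ∀ n (z : 𝔻), (A : 𝔻 → ℂ) z * (K n : 𝔻 → ℂ) z = outerFn g z * k n z := fun n z => by
    change a z * (c⁻¹ * k n z) = _
    rw [hag]
    field_simp
  refine adjoint_toeplitz_injective K (fun n z => ?_) ?_ fun n => ?_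
  · rw [hAK]
    exact hk1 n z (hball z)
  · simpa only [hAK, UnitDisc.coe_zero] using hk0
  · exact ⟨⟨fun z => outerFn g z * k n z, ⟨fun z => outerFn g z * k n z,
      (differentiableOn_outerFn hg).mul (hkd n), fun z => rfl⟩, 1, fun z => hk1 n z (hball z)⟩,
      fun z => (hAK n z).symm⟩

theorem isMatePair_toeplitz {A b : HInf} (hA : A ∈ HInf.unitBall) (hb : b ∈ HInf.unitBall)
    (hab : ∀ᵐ t : ℝ, ∃ α β : ℂ, HasRadialLimit A t α ∧ HasRadialLimit b t β ∧
      ‖α‖ ^ 2 + ‖β‖ ^ 2 = 1) (h0 : (A : 𝔻 → ℂ) 0 ≠ 0)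
    (hinj : Function.Injective (ContinuousLinearMap.adjoint (toeplitz A))) :
    IsMatePair shift (toeplitz A) (toeplitz b) H2.one (starRingEnd ℂ ((A : 𝔻 → ℂ) 0)) where
  adjoint_shift_shift := adjoint_shift_shift
  adjoint_shift_vector := adjoint_shift_one
  inner_vector := by rw [inner_one_left, H2.one_coeff_zero]
  shift_adjoint_shift := shift_adjoint_shift
  comm_left := toeplitz_shift A
  comm_right := toeplitz_shift b
  add_eq := adjoint_toeplitz_add (norm_sq_add_norm_sq_toeplitz hA hb hab)
  adjoint_vector := adjoint_toeplitz_one A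
  ne_zero := (map_ne_zero _).2 h0
  injective := hinj

/-! ### Identification of H(b) with the model space -/

theorem posSqrt_mul_adjoint {H : Type} [NormedAddCommGroup H] [InnerProductSpace ℂ H]
    [CompleteSpace H] {D : H →L[ℂ] H} (hD : 0 ≤ D) (x : H) :
    posSqrt D (ContinuousLinearMap.adjoint (posSqrt D) x) = D x := by
  have h1 : IsSelfAdjoint (posSqrt D) := IsSelfAdjoint.of_nonneg (CFC.sqrt_nonneg D)
  rw [h1.adjoint_eq]
  exact DFunLike.congr_fun (CFC.sqrt_mul_sqrt_self D hD) x

/-- I - T_b T_b* equals P P* for the projection P of the model space. This also supplies the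
positivity without which the square root would not square back to it. -/
theorem Model.exists_isometryEquiv_HSpace {S A : H2 →L[ℂ] H2} {b : HInf} {e : H2} {κ : ℂ}
    (h : IsMatePair S A (toeplitz b) e κ) :
    ∃ Φ : Model A (toeplitz b) ≃ₗᵢ[ℂ] HSpace b,
      ∀ k, HSpace.incl b (Φ k) = Model.proj A (toeplitz b) k := by
  refine RangeSpace.exists_isometryEquiv _ _ (Model.proj_injective h) fun x => ?_
  have hD : Model.proj A (toeplitz b) ∘L ContinuousLinearMap.adjoint (Model.proj A (toeplitz b))
      = 1 - toeplitz b * ContinuousLinearMap.adjoint (toeplitz b) :=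
    ContinuousLinearMap.ext (Model.proj_adjoint h)
  rw [defectRoot, ← hD, posSqrt_mul_adjoint]
  · rfl
  · rw [ContinuousLinearMap.nonneg_iff_isPositive]
    exact ContinuousLinearMap.isPositive_self_comp_adjoint _

end DBR

end

theorem proposition3p2 (b : HInf) (hb : b ∈ HInf.unitBall)
    (hext : b ∉ Set.extremePoints ℝ HInf.unitBall)
    (hconst : ¬ ∃ c : ℂ, ∀ z : 𝔻, (b : 𝔻 → ℂ) z = c)
    (a : 𝔻 → ℂ) (ha : IsPythagoreanMate b a) :
    ∃ (T : HSpace b →L[ℂ] HSpace b) (u : HSpace b),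
      (∀ f : HSpace b, HSpace.incl b (T f) = shift (HSpace.incl b f)) ∧
      HSpace.incl b u = ContinuousLinearMap.adjoint shift (HInf.toH2 b) ∧
      Module.finrank ℂ (LinearMap.range (defect T).toLinearMap) = 1 ∧
      LinearMap.range (defect T).toLinearMap = Submodule.span ℂ {u} ∧
      ∀ l : ℂ, (l ≠ 0 ∧ Module.End.HasEigenvalue (defect T).toLinearMap l) ↔
        l = (((‖a 0‖ ^ 2)⁻¹ * ‖u‖ ^ 2 : ℝ) : ℂ) := by
  obtain ⟨A, rfl, hA, hinj⟩ := ha.exists_HInf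
  have h0 : (A : 𝔻 → ℂ) 0 ≠ 0 := by
    obtain ⟨x, hx, hAx⟩ := ha.apply_zero_pos
    rw [hAx]
    exact_mod_cast hx.ne'
  have h := isMatePair_toeplitz hA hb ha.norm_sq_add_norm_sq h0 hinj
  obtain ⟨Φ, hΦ⟩ := Model.exists_isometryEquiv_HSpace h
  -- The shift of H(b) is transported from the model, so its boundedness comes for free.
  let T : HSpace b →L[ℂ] HSpace b := Φ.toContinuousLinearEquiv.toContinuousLinearMap ∘L
    Model.shiftMap h ∘L Φ.symm.toContinuousLinearEquiv.toContinuousLinearMap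
  have hT : ∀ x, T x = Φ (Model.shiftMap h (Φ.symm x)) := fun x => rfl
  have hu : HSpace.incl b (Φ (Model.vector h))
      = ContinuousLinearMap.adjoint shift (HInf.toH2 b) := hΦ _
  have hu0 : Φ (Model.vector h) ≠ 0 := by
    intro hz
    rw [hz, map_zero] at hu
    -- If S*b = 0, then b = S S*b + b(0) is the constant b(0).
    have h1 := shift_adjoint_shift (HInf.toH2 b)
    rw [← hu, map_zero, zero_add] at h1
    refine hconst ⟨inner ℂ H2.one (HInf.toH2 b), fun z => ?_⟩
    rw [← HInf.toH2_eval, ← h1, H2.eval_smul, H2.eval_one, mul_one, h1]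
  have hc : (‖(A : 𝔻 → ℂ) 0‖ ^ 2)⁻¹ ≠ 0 := inv_ne_zero (pow_ne_zero 2 (norm_ne_zero_iff.2 h0))
  have hdef := defect_apply_of_inner (T := T) (u := Φ (Model.vector h))
    (c := (‖(A : 𝔻 → ℂ) 0‖ ^ 2)⁻¹) fun x y => by
      have e1 : ∀ k, inner ℂ x (Φ k) = (inner ℂ (Φ.symm x) k : ℂ) := fun k => by
        rw [← Φ.inner_map_map, Φ.apply_symm_apply]
      have e2 : ∀ k, inner ℂ (Φ k) y = (inner ℂ k (Φ.symm y) : ℂ) := fun k => by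
        rw [← Φ.inner_map_map k, Φ.apply_symm_apply]
      rw [hT, hT, Φ.inner_map_map, Model.inner_shiftMap, Φ.symm.inner_map_map, e1, e2,
        RCLike.norm_conj, Complex.ofReal_inv]
  have hrange : LinearMap.range (defect T).toLinearMap = Submodule.span ℂ {Φ (Model.vector h)} :=
    range_defect_of_inner hc hu0 hdef
  refine ⟨T, Φ (Model.vector h), fun f => ?_, hu, ?_, hrange,
    hasEigenvalue_defect_of_inner hc hu0 hdef⟩
  · obtain ⟨k, rfl⟩ := Φ.surjective f
    rw [hT, Φ.symm_apply_apply, hΦ, hΦ]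
    rfl
  · rw [hrange]
    exact finrank_span_singleton hu0
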